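/- Setting. Let $\mathbb{R}^p$ carry a norm $\|\cdot\|_{\mathcal X}$. For each sample size $n$ let $x_i\in\mathbb{R}^p$, $d_i\in\{0,1\}$, $i=1,\dots,n$, be nonrandom (they may depend on $n$), let $C_n>0$, and let $\mathcal F_{\mathrm{Lip}}(C)$ be the set of all $f:\mathbb{R}^p\times\{0,1\}\to\mathbb{R}$ with $|f(x,d)-f(\tilde x,d)|\le C\|x-\tilde x\|_{\mathcal X}$ for all $x,\tilde x,d$. One observes $y_i=f(x_i,d_i)+u_i$ with $u_1,\dots,u_n$ independent, $Eu_i=0$, $Eu_i^2=\sigma^2(x_i,d_i)$, where the law of the errors does not depend on $f$; $P_f$ is the law under $f$. Let $Lf=\frac1n\sum_{i=1}^n[f(x_i,1)-f(x_i,0)]$. Confidence interval. Fix $M\ge1$ and $\alpha\in(0,1)$. Match each unit $i$ to $M$ units closest to it in $\|\cdot\|_{\mathcal X}$ among those with treatment status $1-d_i$ (ties broken in any nonrandom way), let $K_M(i)$ be the number of times that unit $i$ is used as a match, and let $$k_i=\frac1n(2d_i-1)\Big(1+\frac{K_M(i)}M\Big),\qquad \hat L=\sum_{i=1}^nk_iy_i,\qquad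 B_n=\sup_{f\in\mathcal F_{\mathrm{Lip}}(C_n)}\Big[\sum_{i=1}^nk_if(x_i,d_i)-Lf\Big].$$ Let $\mathrm{cv}_\alpha(b)$ be the $1-\alpha$ quantile of $|N(b,1)|$. Given variance estimates $\hat u_i^2$, let $\mathrm{se}^2=\sum_{i=1}^nk_i^2\hat u_i^2$ and let $$\mathcal C=\big[\hat L-\mathrm{cv}_\alpha(B_n/\mathrm{se})\,\mathrm{se},\ \hat L+\mathrm{cv}_\alpha(B_n/\mathrm{se})\,\mathrm{se}\big].$$ Theorem. Suppose that for some constant $K>0$, $1/K\le Eu_i^2\le K$ and $E|u_i|^{2+1/K}\le K$ for all $n$ and $i$; that $\sigma^2(x,d)$ is uniformly continuous in $x$ for $d\in\{0,1\}$; and that for all $\eta>0$ $$\min_{1\le i\le n}\#\{j:\|x_j-x_i\|_{\mathcal X}\le\eta/C_n,\ d_j=d_i\}\to\infty .$$ Let $\mathcal X\subseteq\mathbb{R}^p$ contain all the $x_i$ and let $\overline G,\underline G:(0,\infty)\to(0,\infty)$ be functions such that $\underline G$ has an inverse $\underline G^{-1}$ near zero (that is, $\underline G^{-1}(t)>0$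 and $\underline G(\underline G^{-1}(t))=t$ for all small $t>0$) and $\lim_{t\downarrow0}\overline G(\underline G^{-1}(t))^2/[t/\log t^{-1}]=0$. Suppose that for every sequence $a_n>0$ with $n\underline G(a_n)/\log n\to\infty$ one has, for all large enough $n$, $$\underline G(a_n)\le\frac{\#\{i:\|x_i-x\|_{\mathcal X}\le a_n,\ d_i=d\}}n\le\overline G(a_n)\qquad\text{for all }x\in\mathcal X,\ d\in\{0,1\}.$$ Then $$\liminf_{n\to\infty}\ \inf_{f\in\mathcal F_{\mathrm{Lip}}(C_n)}P_f(Lf\in\mathcal C)\ge1-\alpha$$ for each of the following choices of $\hat u_i^2$: (a) the nearest-neighbor variance estimator $\hat u_i^2=\frac J{J+1}\big(y_i-\frac1J\sum_{j\in N_i}y_j\big)^2$, where $J\ge1$ is fixed and $N_i$ consists of $J$ units other than $i$ with treatment status $d_i$ closest to $i$ in some fixed norm on $\mathbb{R}^p$ (ties broken in any nonrandom way); (b) $\hat u_i^2=(y_i-\hat f(x_i,d_i))^2$, where $\hat f(x_i,d_i)$ is the average of $y_j$ over $\{j:\|x_j-x_i\|_{\mathcal X}\le h_n,\ d_j=d_i\}$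 (the Nadaraya–Watson estimator with uniform kernel), with $h_nC_n\to0$ slowly enough in the sense that $\min_{1\le i\le n}\#\{j:\|x_j-x_i\|_{\mathcal X}\le h_n,\ d_j=d_i\}\to\infty$. Moreover, the condition in (b) does hold for all sufficiently slow bandwidths: there is a sequence $\rho_n>0$, $\rho_n\to0$, such that $\min_{1\le i\le n}\#\{j:\|x_j-x_i\|_{\mathcal X}\le h_n,\ d_j=d_i\}\to\infty$ whenever $h_nC_n\ge\rho_n$ for all large $n$. -/

import Mathlib

open Filter Topology MeasureTheory ProbabilityTheory

noncomputable section

namespace BiasAwareCI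

variable {E : Type*} [NormedAddCommGroup E]

/-- The Lipschitz class with constant `C`: functions `f (x, d)` of a covariate value `x` and a
treatment status `d` (`true` is treated, `false` is untreated) that are `C`-Lipschitz in `x` for
each `d`. The norm of `E` is the norm on covariates. -/
def FLip (C : ℝ) : Set (E → Bool → ℝ) :=
  {f | ∀ (d : Bool) (x x' : E), |f x d - f x' d| ≤ C * ‖x - x'‖}

/-- The number of units with treatment status `t` and covariate within distance `r` of `c`. -/
def ballCount {n : ℕ} (x : Fin n → E) (d : Fin n → Bool) (c : E) (t : Bool) (r : ℝ) : ℕ :=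
  (Finset.univ.filter fun j => ‖x j - c‖ ≤ r ∧ d j = t).card

/-- The conditional average treatment effect `L f`. -/
def cate {n : ℕ} (x : Fin n → E) (f : E → Bool → ℝ) : ℝ :=
  (1 / (n : ℝ)) * ∑ i, (f (x i) true - f (x i) false)

/-- The outcomes `y i = f (x i, d i) + u i`. -/
def outcome {n : ℕ} (x : Fin n → E) (d : Fin n → Bool) (f : E → Bool → ℝ) (u : Fin n → ℝ) :
    Fin n → ℝ :=
  fun i => f (x i) (d i) + u i

/-- The linear estimator with weights `k`. -/
def linEst {n : ℕ} (k y : Fin n → ℝ) : ℝ := ∑ i, k i * y i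

/-- The worst-case bias over `FLip C` of the linear estimator with weights `k`. (The supremum is
over a nonempty set; it is finite when the weights of the treated sum to `1` and those of the
untreated to `-1`, as for a matching estimator.) -/
def maxBias {n : ℕ} (C : ℝ) (x : Fin n → E) (d : Fin n → Bool) (k : Fin n → ℝ) : ℝ :=
  ⨆ f : (FLip C : Set (E → Bool → ℝ)), (∑ i, k i * f.1 (x i) (d i) - cate x f.1)

/-- `S` consists of `k` elements of `A` at which the distance `dist` is smallest; ties may be
broken in any way. -/
def IsNearestSet {n : ℕ} (dist : Fin n → ℝ) (A : Finset (Fin n)) (k : ℕ) (S : Finset (Fin n)) :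
    Prop :=
  S ⊆ A ∧ S.card = k ∧ ∀ j ∈ S, ∀ l ∈ A, l ∉ S → dist j ≤ dist l

/-- For every unit `i`, `S i` is a set of `M` units closest to `i` (in the norm of `E`) among the
units with the opposite treatment status. -/
def IsMatching {n : ℕ} (x : Fin n → E) (d : Fin n → Bool) (M : ℕ) (S : Fin n → Finset (Fin n)) :
    Prop :=
  ∀ i, IsNearestSet (fun j => ‖x j - x i‖) (Finset.univ.filter fun j => d j ≠ d i) M (S i)

/-- The weights `(1/n) (2 d i - 1) (1 + K i / M)` of the matching estimator, where `K i` is the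
number of times that unit `i` is used as a match. -/
def matchWeight {n : ℕ} (d : Fin n → Bool) (M : ℕ) (S : Fin n → Finset (Fin n)) (i : Fin n) : ℝ :=
  (1 / (n : ℝ)) * (if d i then 1 else -1) *
    (1 + ((Finset.univ.filter fun j => i ∈ S j).card : ℝ) / M)

/-- For every unit `i`, `N i` is a set of `J` units closest to `i` in the norm `ν` among the other
units with the same treatment status. -/
def IsNeighborSystem [NormedSpace ℝ E] {n : ℕ} (ν : Seminorm ℝ E) (x : Fin n → E)
    (d : Fin n → Bool) (J : ℕ) (N : Fin n → Finset (Fin n)) : Prop :=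
  ∀ i, IsNearestSet (fun j => ν (x j - x i))
    (Finset.univ.filter fun j => j ≠ i ∧ d j = d i) J (N i)

/-- The nearest-neighbor estimates of the variances. -/
def nnVar {n : ℕ} (J : ℕ) (N : Fin n → Finset (Fin n)) (y : Fin n → ℝ) (i : Fin n) : ℝ :=
  (J : ℝ) / ((J : ℝ) + 1) * (y i - (1 / (J : ℝ)) * ∑ j ∈ N i, y j) ^ 2

/-- The units with the treatment status of `i` and covariate within distance `h` of `x i`. -/
def window {n : ℕ} (x : Fin n → E) (d : Fin n → Bool) (h : ℝ) (i : Fin n) : Finset (Fin n) :=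
  Finset.univ.filter fun j => ‖x j - x i‖ ≤ h ∧ d j = d i

/-- The squared residuals from the Nadaraya-Watson regression estimator with uniform kernel and
bandwidth `h`. -/
def nwVar {n : ℕ} (x : Fin n → E) (d : Fin n → Bool) (h : ℝ) (y : Fin n → ℝ) (i : Fin n) : ℝ :=
  (y i - (∑ j ∈ window x d h i, y j) / ((window x d h i).card : ℝ)) ^ 2

/-- The `1 - α` quantile of the absolute value of an `N(b, 1)` random variable. -/
def cv (α b : ℝ) : ℝ :=
  sInf {c : ℝ | 1 - α ≤ (gaussianReal b 1).real {z | |z| ≤ c}}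

/-- The robust standard error computed from the variance estimates `v`. -/
def stdErr {n : ℕ} (k v : Fin n → ℝ) : ℝ := Real.sqrt (∑ i, k i ^ 2 * v i)

/-- The feasible bias-aware confidence interval: estimate plus or minus
`cv α (maximal bias / standard error)` times the standard error. -/
def feasibleCI {n : ℕ} (α C : ℝ) (x : Fin n → E) (d : Fin n → Bool) (k v y : Fin n → ℝ) : Set ℝ :=
  Set.Icc
    (linEst k y - cv α (maxBias C x d k / stdErr k v) * stdErr k v)
    (linEst k y + cv α (maxBias C x d k / stdErr k v) * stdErr k v)

/-- The number of units with the treatment status of `i` in the ball of radius `r n` around `x i`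
tends to infinity uniformly in `i`. -/
def MinCountTendsto (x : (n : ℕ) → Fin n → E) (d : (n : ℕ) → Fin n → Bool) (r : ℕ → ℝ) : Prop :=
  ∀ B : ℕ, ∀ᶠ n in atTop, ∀ i : Fin n, B ≤ ballCount (x n) (d n) (x n i) (d n i) (r n)

/-- The asymptotic coverage of the feasible confidence interval with weights `k n` and variance
estimates `v n y` is at least `1 - α`, uniformly over the regression function in `FLip (C n)`. -/
def UniformlyValid {Ω : ℕ → Type*} [∀ n, MeasurableSpace (Ω n)] (μ : (n : ℕ) → Measure (Ω n))
    (u : (n : ℕ) → Fin n → Ω n → ℝ) (α : ℝ) (C : ℕ → ℝ)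
    (x : (n : ℕ) → Fin n → E) (d : (n : ℕ) → Fin n → Bool) (k : (n : ℕ) → Fin n → ℝ)
    (v : (n : ℕ) → (Fin n → ℝ) → Fin n → ℝ) : Prop :=
  1 - α ≤ liminf (fun n =>
    ⨅ f : (FLip (C n) : Set (E → Bool → ℝ)),
      (μ n).real {ω | cate (x n) f.1 ∈
        feasibleCI α (C n) (x n) (d n) (k n)
          (v n (outcome (x n) (d n) f.1 fun i => u n i ω))
          (outcome (x n) (d n) f.1 fun i => u n i ω)}) atTop

end BiasAwareCI

end

/-!
Write the estimation error as a bias plus `s * Z`, with `Z` a weighted sum of independent errors of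
unit variance. The bias is at most `maxBias`, since the Lipschitz class is symmetric
(`abs_matching_bias_le_maxBias`). What remains is that `Z` is close to normal on all intervals at
once, and that `se / s` tends to `1` in probability, uniformly over the regression function. These
two facts give coverage for any bias and any ratio of bias to standard error, because the
probability `coverProb b c` that `|b + N(0, 1)| ≤ c` decreases in `|b|`, is Lipschitz in `c`, and
is stable under a small change of the scale of the noise (`le_coverage`,
`uniformlyValid_of_variance_consistent`).

*Normality.* Characteristic functions converge under a Lindeberg condition
(`norm_charFun_sum_sub_le`). Weak convergence to a normal law is uniform over intervals, which is
read off from the Lévy-Prokhorov distance (`eventually_coverProb_le`).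

*Weights.* The overlap condition provides radii `a n` at which balls hold enough units for all
matches, but only `o (√n)` units (`exists_radius`). Hence a unit is used as a match `o (√n)` times.
Counting the matches of all units in a ball, and covering a ball of radius `R * a n` by boundedly
many balls of radius `a n`, gives more: the squared weights of all the units in such a ball add up
to a negligible part of the total (`sum_window_matchWeight_sq_le`).

*Variances.* All consistency statements hold in `L¹` with explicit bounds. Squared errors satisfy a
weak law by truncation (`integral_abs_sum_sq_sub_le`). For the Nadaraya-Watson residuals the fitted
values are accurate in mean square, so replacing errors by residuals costs little
(`integral_abs_sum_residual_sq_sub_le`). The nearest-neighbor estimates do not have accurate fitted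
values; there the weighted sum is a quadratic form in the errors, whose diagonal obeys the weak law
and whose off-diagonal part has uncorrelated terms, provided that each error has small total
influence (`integral_abs_sum_sq_linear_sub_le`). This is where the negligibility of the weights of
all the units near a given one is needed. Neighbors are close both on the scale `1 / C n`, so that
the regression function hardly varies, and absolutely, so that the variance hardly varies; the
latter follows from the overlap condition at constant radii.
-/

namespace BiasAwareCI

open scoped NNReal ENNReal

/-! ### The coverage probability of intervals under a normal law -/

/-- `coverProb b c` is the probability that `|b + Z| ≤ c` for a standard normal `Z`. -/
noncomputable def coverProb (b c : ℝ) : ℝ := (gaussianReal 0 1).real {z | |b + z| ≤ c}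

lemma measurableSet_abs_add_le (b c : ℝ) : MeasurableSet {z : ℝ | |b + z| ≤ c} :=
  measurableSet_le (by fun_prop) (by fun_prop)

lemma gaussianReal_real_abs_le (b c : ℝ) :
    (gaussianReal b 1).real {z | |z| ≤ c} = coverProb b c := by
  have h := gaussianReal_map_const_add (μ := 0) (v := 1) b
  rw [zero_add] at h
  rw [← h, coverProb, map_measureReal_apply (by fun_prop)]
  · rfl
  · exact measurableSet_le (by fun_prop) (by fun_prop)

lemma gaussianPDFReal_le_one (x : ℝ) : gaussianPDFReal 0 1 x ≤ 1 := by
  rw [gaussianPDFReal_def]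
  have h1 : (1 : ℝ) ≤ √(2 * Real.pi * (1 : ℝ≥0)) := by
    rw [Real.one_le_sqrt]
    have := Real.pi_gt_three
    push_cast
    linarith
  have h2 : Real.exp (-(x - 0) ^ 2 / (2 * (1 : ℝ≥0))) ≤ 1 := by
    rw [Real.exp_le_one_iff]
    push_cast
    nlinarith [sq_nonneg (x - 0)]
  have h3 : (√(2 * Real.pi * (1 : ℝ≥0)))⁻¹ ≤ 1 := inv_le_one_of_one_le₀ h1
  have h5 := Real.exp_pos (-(x - 0) ^ 2 / (2 * (1 : ℝ≥0)))
  exact mul_le_one₀ h3 h5.le h2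

lemma gaussianReal_real_Icc {a b : ℝ} (h : a ≤ b) :
    (gaussianReal 0 1).real (Set.Icc a b) = ∫ x in a..b, gaussianPDFReal 0 1 x := by
  rw [measureReal_def, gaussianReal_apply_eq_integral _ one_ne_zero, ENNReal.toReal_ofReal,
    integral_Icc_eq_integral_Ioc, intervalIntegral.integral_of_le h]
  exact integral_nonneg fun x => gaussianPDFReal_nonneg _ _ _

lemma gaussianReal_real_Icc_le {a b : ℝ} (h : a ≤ b) :
    (gaussianReal 0 1).real (Set.Icc a b) ≤ b - a := by
  rw [gaussianReal_real_Icc h]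
  calc _ ≤ ∫ _ in a..b, (1 : ℝ) := by
        apply intervalIntegral.integral_mono_on h
        · exact (integrable_gaussianPDFReal 0 1).intervalIntegrable
        · simp
        · exact fun x _ => gaussianPDFReal_le_one x
    _ = b - a := by simp

/-- The normal density is at most `1`, so `coverProb` is `2`-Lipschitz in the length. -/
lemma coverProb_add_le (b c : ℝ) {η : ℝ} (hη : 0 ≤ η) :
    coverProb b (c + η) ≤ coverProb b c + 2 * η := by
  have hsub : {z : ℝ | |b + z| ≤ c + η} ⊆ {z | |b + z| ≤ c} ∪
      (Set.Icc (-b - c - η) (-b - c) ∪ Set.Icc (c - b) (c - b + η)) := by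
    intro z hz
    simp only [Set.mem_ofPred_eq, Set.mem_union, Set.mem_Icc, abs_le] at hz ⊢
    grind
  calc coverProb b (c + η) ≤ _ := measureReal_mono hsub
    _ ≤ _ := measureReal_union_le _ _
    _ ≤ coverProb b c + (η + η) := by
        refine add_le_add le_rfl ((measureReal_union_le _ _).trans ?_)
        refine add_le_add ((gaussianReal_real_Icc_le (by linarith)).trans (by linarith))
          ((gaussianReal_real_Icc_le (by linarith)).trans (by linarith))
    _ = _ := by ring

lemma coverProb_mono (b : ℝ) {c c' : ℝ} (h : c ≤ c') : coverProb b c ≤ coverProb b c' :=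
  measureReal_mono fun _ hz => le_trans hz h

lemma coverProb_of_neg (b : ℝ) {c : ℝ} (h : c < 0) : coverProb b c = 0 := by
  have : {z : ℝ | |b + z| ≤ c} = ∅ := by
    ext z
    simp only [Set.mem_ofPred_eq, Set.mem_empty_iff_false, iff_false, not_le]
    exact h.trans_le (abs_nonneg _)
  rw [coverProb, this, measureReal_empty]

lemma coverProb_neg (b c : ℝ) : coverProb (-b) c = coverProb b c := by
  have h := gaussianReal_map_neg (μ := 0) (v := 1)
  rw [neg_zero] at h
  rw [coverProb, ← h, map_measureReal_apply (by fun_prop) (measurableSet_abs_add_le _ _), coverProb]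
  congr 1
  ext z
  simp only [Set.mem_preimage, Set.mem_ofPred_eq, ← neg_add, abs_neg]

lemma gaussianPDFReal_le_of_abs_le {x y : ℝ} (h : |x| ≤ |y|) :
    gaussianPDFReal 0 1 y ≤ gaussianPDFReal 0 1 x := by
  have := sq_le_sq.2 h
  simp only [gaussianPDFReal_def]
  refine mul_le_mul_of_nonneg_left (Real.exp_le_exp.2 ?_) (by positivity)
  refine div_le_div_of_nonneg_right ?_ (by positivity)
  simpa using this

/-- The interval `[-c, c]` is less likely under `N(b, 1)` the farther `b` is from zero. -/
lemma coverProb_le_of_abs_le {b β : ℝ} (h : |β| ≤ b) (c : ℝ) : coverProb b c ≤ coverProb β c := by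
  wlog hβ : 0 ≤ β generalizing β
  · rw [← coverProb_neg β]
    exact this (by rwa [abs_neg]) (by linarith)
  rw [abs_of_nonneg hβ] at h
  rcases lt_or_ge c 0 with hc | hc
  · rw [coverProb_of_neg b hc, coverProb_of_neg β hc]
  have hcp : ∀ t, coverProb t c = ∫ x in (-c - t)..(c - t), gaussianPDFReal 0 1 x := by
    intro t
    rw [← gaussianReal_real_Icc (by linarith), coverProb]
    congr 1
    ext z
    simp only [Set.mem_ofPred_eq, abs_le, Set.mem_Icc]
    constructor <;> intro h <;> constructor <;> linarith [h.1, h.2]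
  have hi : ∀ s t, IntervalIntegrable (gaussianPDFReal 0 1) volume s t := fun s t =>
    (integrable_gaussianPDFReal 0 1).intervalIntegrable
  have e1 := intervalIntegral.integral_add_adjacent_intervals (hi (-c - b) (-c - β))
    (hi (-c - β) (c - β))
  have e2 := intervalIntegral.integral_add_adjacent_intervals (hi (-c - b) (c - b))
    (hi (c - b) (c - β))
  have e3 : ∫ x in (c - b)..(c - β), gaussianPDFReal 0 1 x =
      ∫ t in β..b, gaussianPDFReal 0 1 (c - t) := by
    rw [intervalIntegral.integral_comp_sub_left]
  have e4 : ∫ x in (-c - b)..(-c - β), gaussianPDFReal 0 1 x =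
      ∫ t in β..b, gaussianPDFReal 0 1 (-c - t) := by
    rw [intervalIntegral.integral_comp_sub_left]
  -- moving the center from `β` to `b` loses the points `c - t` and gains the points `-c - t`,
  -- which are farther from zero
  have e5 : ∫ t in β..b, gaussianPDFReal 0 1 (-c - t) ≤
      ∫ t in β..b, gaussianPDFReal 0 1 (c - t) := by
    apply intervalIntegral.integral_mono_on h
    · exact ((integrable_gaussianPDFReal 0 1).comp_sub_left _).intervalIntegrable
    · exact ((integrable_gaussianPDFReal 0 1).comp_sub_left _).intervalIntegrable
    · intro t ht
      apply gaussianPDFReal_le_of_abs_le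
      rw [← sq_le_sq]
      nlinarith [ht.1, ht.2, mul_nonneg hc (hβ.trans ht.1)]
  rw [hcp, hcp]
  linarith

/-- A change of the scale of the noise by a factor `r` close to `1` costs little coverage after a
small enlargement of the interval. -/
lemma coverProb_div_le (b c : ℝ) {r ε T : ℝ} (hr : 0 < r) (hrε : |r - 1| ≤ ε) :
    coverProb (b / r) c ≤
      coverProb b (r * c + ε * T) + (gaussianReal 0 1).real {z | T < |z|} := by
  refine (measureReal_mono (s₂ := {z : ℝ | |b + z| ≤ r * c + ε * T} ∪ {z | T < |z|}) ?_).trans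
    (measureReal_union_le _ _)
  intro z hz
  simp only [Set.mem_ofPred_eq, Set.mem_union] at hz ⊢
  by_cases hT : T < |z|
  · exact Or.inr hT
  left
  have h1 : b + z = r * (b / r + z) - (r - 1) * z := by field_simp; ring
  calc |b + z| ≤ |r * (b / r + z)| + |(r - 1) * z| := by rw [h1]; exact abs_sub _ _
    _ ≤ r * c + ε * T := by
        rw [abs_mul, abs_mul, abs_of_pos hr]
        have := (abs_nonneg (r - 1)).trans hrε
        gcongr
        exact not_lt.1 hT

lemma tendsto_coverProb_atTop (b : ℝ) : Tendsto (coverProb b) atTop (𝓝 1) := by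
  have h : Tendsto (fun c : ℝ => (gaussianReal 0 1).real {z | |b + z| ≤ c}) atTop
      (𝓝 ((gaussianReal 0 1).real (⋃ c : ℝ, {z | |b + z| ≤ c}))) := by
    have := tendsto_measure_iUnion_atTop (μ := gaussianReal 0 1)
      (s := fun c : ℝ => {z : ℝ | |b + z| ≤ c}) (fun c c' h z hz => le_trans hz h)
    exact (ENNReal.tendsto_toReal (measure_ne_top _ _)).comp this
  have hU : (⋃ c : ℝ, {z : ℝ | |b + z| ≤ c}) = Set.univ := by
    ext z
    simpa using ⟨|b + z|, le_rfl⟩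
  rwa [hU, probReal_univ] at h

lemma exists_gaussian_tail_le {δ : ℝ} (hδ : 0 < δ) :
    ∃ T : ℝ, 0 < T ∧ (gaussianReal 0 1).real {z | T < |z|} ≤ δ := by
  have h := (tendsto_coverProb_atTop 0).eventually (lt_mem_nhds (show 1 - δ < 1 by linarith))
  obtain ⟨T, hT, hT0⟩ := (h.and (eventually_gt_atTop 0)).exists
  refine ⟨T, hT0, ?_⟩
  have : {z : ℝ | T < |z|} = {z | |0 + z| ≤ T}ᶜ := by
    ext z
    simp
  rw [this, probReal_compl_eq_one_sub (measurableSet_abs_add_le _ _)]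
  unfold coverProb at hT
  linarith

lemma cv_eq (α b : ℝ) : cv α b = sInf {c : ℝ | 1 - α ≤ coverProb b c} := by
  simp only [cv, gaussianReal_real_abs_le]

lemma nonneg_of_le_coverProb {α b c : ℝ} (hα : α < 1) (h : 1 - α ≤ coverProb b c) : 0 ≤ c := by
  by_contra hc
  rw [coverProb_of_neg b (not_le.1 hc)] at h
  linarith

lemma cv_le {α b c : ℝ} (hα : α < 1) (h : 1 - α ≤ coverProb b c) : cv α b ≤ c := by
  rw [cv_eq]
  exact csInf_le ⟨0, fun _ hx => nonneg_of_le_coverProb hα hx⟩ h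

/-- The infimum in the definition of the critical value is attained. -/
lemma le_coverProb_cv {α : ℝ} (hα : α ∈ Set.Ioo (0 : ℝ) 1) (b : ℝ) :
    1 - α ≤ coverProb b (cv α b) := by
  have hne : {c : ℝ | 1 - α ≤ coverProb b c}.Nonempty :=
    ((tendsto_coverProb_atTop b).eventually
      (le_mem_nhds (show 1 - α < 1 by linarith [hα.1]))).exists
  refine le_of_forall_pos_le_add fun ε hε => ?_
  obtain ⟨c, hc, hlt⟩ := exists_lt_of_csInf_lt hne
    (show sInf {c : ℝ | 1 - α ≤ coverProb b c} < cv α b + ε / 2 by rw [← cv_eq]; linarith)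
  have h1 : 1 - α ≤ coverProb b c := hc
  have h2 := coverProb_mono b hlt.le
  have h3 := coverProb_add_le b (cv α b) (half_pos hε).le
  linarith

/-! ### The central limit theorem, uniformly over intervals -/

/-- Weak convergence to the standard normal law gives coverage of intervals uniformly in their
location and length: this is how the Lévy-Prokhorov distance reads for intervals. -/
lemma eventually_coverProb_le {P : ℕ → ProbabilityMeasure ℝ}
    (hP : Tendsto P atTop (𝓝 ⟨gaussianReal 0 1, inferInstance⟩)) {ε : ℝ} (hε : 0 < ε) :
    ∀ᶠ n in atTop, ∀ b c : ℝ,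
      coverProb b c ≤ (P n : Measure ℝ).real {z | |b + z| ≤ c} + ε := by
  have h := (LevyProkhorov.probabilityMeasureHomeomorph.continuous.tendsto _).comp hP
  have hpos : 0 < ε / 3 := by linarith
  have h2 := h.eventually (Metric.eball_mem_nhds _ (ENNReal.ofReal_pos.2 hpos))
  filter_upwards [h2] with n hn b c
  have hn' : levyProkhorovEDist (P n : Measure ℝ) (gaussianReal 0 1) < ENNReal.ofReal (ε / 3) := hn
  have h3 := right_measure_le_of_levyProkhorovEDist_lt hn' (measurableSet_abs_add_le b (c - ε / 3))
  rw [ENNReal.toReal_ofReal hpos.le] at h3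
  have hsub : Metric.thickening (ε / 3) {z : ℝ | |b + z| ≤ c - ε / 3} ⊆ {z | |b + z| ≤ c} := by
    intro z hz
    obtain ⟨w, hw, hzw⟩ := Metric.mem_thickening_iff.1 hz
    rw [Real.dist_eq] at hzw
    have hw' : |b + w| ≤ c - ε / 3 := hw
    have : |b + z| ≤ |b + w| + |z - w| := by
      rw [show b + z = (b + w) + (z - w) by ring]
      exact abs_add_le _ _
    change |b + z| ≤ c
    linarith
  have h4 : coverProb b (c - ε / 3) ≤ (P n : Measure ℝ).real {z | |b + z| ≤ c} + ε / 3 := by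
    have h5 := ENNReal.toReal_mono (by finiteness)
      (h3.trans (add_le_add (measure_mono hsub) le_rfl))
    rwa [ENNReal.toReal_add (by finiteness) (by finiteness),
      ENNReal.toReal_ofReal hpos.le] at h5
  have h6 := coverProb_add_le b (c - ε / 3) hpos.le
  rw [sub_add_cancel] at h6
  linarith

lemma abs_sin_sub_le (y : ℝ) : |Real.sin y - y| ≤ |y| ^ 3 / 6 ∧ |Real.sin y - y| ≤ 2 * y ^ 2 := by
  wlog h : 0 ≤ y generalizing y
  · have := this (-y) (by linarith)
    rwa [Real.sin_neg, abs_neg, neg_sq, ← neg_sub', abs_neg] at this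
  have h1 := Real.sin_le h
  have h2 := Real.sin_ge_sub_cube h
  have h3 := Real.neg_one_le_sin y
  rw [abs_of_nonpos (by linarith), abs_of_nonneg h]
  refine ⟨by linarith, ?_⟩
  rcases le_total y 1 with hy | hy
  · nlinarith [mul_nonneg h h, mul_nonneg (mul_nonneg h h) (sub_nonneg.2 hy)]
  · nlinarith

lemma abs_cos_sub_le (y : ℝ) :
    |Real.cos y - 1 + y ^ 2 / 2| ≤ |y| ^ 3 / 2 ∧ |Real.cos y - 1 + y ^ 2 / 2| ≤ y ^ 2 / 2 := by
  have h1 := Real.one_sub_sq_div_two_le_cos (x := y)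
  have h2 := Real.cos_le_one y
  rw [abs_of_nonneg (by linarith)]
  refine ⟨?_, by linarith⟩
  have hs := abs_le.1 (abs_sin_sub_le (y / 2)).1
  have hs' := abs_le.1 (Real.abs_sin_le_abs (x := y / 2))
  have hc : Real.cos y = 1 - 2 * Real.sin (y / 2) ^ 2 := by
    have := Real.cos_two_mul (y / 2)
    rw [mul_div_cancel₀ _ two_ne_zero] at this
    have := Real.sin_sq_add_cos_sq (y / 2)
    linarith
  have hy2 := sq_abs y
  have hy0 := abs_nonneg y
  rw [abs_div, abs_two] at hs hs'
  rcases le_total |y| 1 with hy | hy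
  · have h3 : |y / 2 - Real.sin (y / 2)| ≤ (|y| / 2) ^ 3 / 6 := by
      rw [abs_sub_comm]; exact abs_le.2 hs
    have h4 : |y / 2 + Real.sin (y / 2)| ≤ |y| := by
      refine (abs_add_le _ _).trans ?_
      have := abs_le.2 hs'
      rw [abs_div, abs_two]
      linarith
    have h5 : Real.cos y - 1 + y ^ 2 / 2 =
        2 * ((y / 2 - Real.sin (y / 2)) * (y / 2 + Real.sin (y / 2))) := by rw [hc]; ring
    rw [h5]
    have h6 := (le_abs_self _).trans_eq (abs_mul (y / 2 - Real.sin (y / 2)) (y / 2 + Real.sin (y / 2)))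
    have h7 := mul_le_mul h3 h4 (abs_nonneg _) (by positivity)
    have h8 : 0 ≤ |y| ^ 3 := by positivity
    nlinarith
  · nlinarith [mul_nonneg hy0 hy0]

/-- Second-order Taylor expansion of `exp (i y)`: the remainder is at most cubic near zero and at
most quadratic everywhere. -/
lemma norm_exp_mul_I_sub_le (y : ℝ) :
    ‖Complex.exp (y * Complex.I) - (1 + y * Complex.I - y ^ 2 / 2)‖ ≤ |y| ^ 3 ∧
    ‖Complex.exp (y * Complex.I) - (1 + y * Complex.I - y ^ 2 / 2)‖ ≤ 3 * y ^ 2 := by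
  have h : Complex.exp (y * Complex.I) - (1 + y * Complex.I - y ^ 2 / 2) =
      ((Real.cos y - 1 + y ^ 2 / 2 : ℝ) : ℂ) + ((Real.sin y - y : ℝ) : ℂ) * Complex.I := by
    rw [Complex.exp_mul_I]
    push_cast
    ring
  have h2 : ‖((Real.cos y - 1 + y ^ 2 / 2 : ℝ) : ℂ) + ((Real.sin y - y : ℝ) : ℂ) * Complex.I‖ ≤
      |Real.cos y - 1 + y ^ 2 / 2| + |Real.sin y - y| := by
    refine (norm_add_le _ _).trans_eq ?_
    simp only [norm_mul, Complex.norm_real, Complex.norm_I, mul_one, Real.norm_eq_abs]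
  rw [h]
  have := abs_cos_sub_le y
  have := abs_sin_sub_le y
  have : 0 ≤ |y| ^ 3 := by positivity
  constructor <;> nlinarith
lemma norm_prod_sub_prod_le {ι : Type*} (s : Finset ι) (a b : ι → ℂ) (ha : ∀ i, ‖a i‖ ≤ 1)
    (hb : ∀ i, ‖b i‖ ≤ 1) : ‖∏ i ∈ s, a i - ∏ i ∈ s, b i‖ ≤ ∑ i ∈ s, ‖a i - b i‖ := by
  classical
  induction s using Finset.induction_on with
  | empty => simp
  | insert i s hi ih =>
    rw [Finset.prod_insert hi, Finset.prod_insert hi, Finset.sum_insert hi]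
    have h : a i * ∏ j ∈ s, a j - b i * ∏ j ∈ s, b j =
        (a i - b i) * ∏ j ∈ s, a j + b i * (∏ j ∈ s, a j - ∏ j ∈ s, b j) := by ring
    rw [h]
    refine (norm_add_le _ _).trans (add_le_add ?_ ?_)
    · rw [norm_mul, norm_prod]
      exact mul_le_of_le_one_right (norm_nonneg _) (Finset.prod_le_one (fun _ _ => norm_nonneg _)
        fun j _ => ha j)
    · rw [norm_mul]
      exact (mul_le_of_le_one_left (norm_nonneg _) (hb i)).trans ih


lemma abs_exp_neg_sub_le {x : ℝ} (hx : 0 ≤ x) : |Real.exp (-x) - (1 - x)| ≤ x ^ 2 := by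
  have h1 := Real.add_one_le_exp (-x)
  have h2 := Real.add_one_le_exp x
  rw [abs_of_nonneg (by linarith), Real.exp_neg]
  have h3 : (Real.exp x)⁻¹ ≤ (x + 1)⁻¹ := inv_anti₀ (by linarith) h2
  have h4 : (x + 1)⁻¹ ≤ 1 - x + x ^ 2 := by
    rw [inv_le_iff_one_le_mul₀ (by linarith)]
    nlinarith [pow_nonneg hx 3]
  linarith

section
variable {Ω : Type*} [MeasurableSpace Ω] {μ : Measure Ω} [IsProbabilityMeasure μ]

/-- The second-order expansion of a characteristic function, with a remainder that only uses the
truncated second moment beyond the level `T`. -/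
lemma norm_charFun_sub_le {u : Ω → ℝ} (hu : Measurable u) (h1 : Integrable u μ)
    (h0 : ∫ ω, u ω ∂μ = 0) (h2 : Integrable (fun ω => u ω ^ 2) μ) (T : ℝ) (hT : 0 ≤ T) (s : ℝ) :
    ‖charFun (μ.map u) s - ((1 - s ^ 2 * (∫ ω, u ω ^ 2 ∂μ) / 2 : ℝ) : ℂ)‖ ≤
      |s| ^ 3 * T * (∫ ω, u ω ^ 2 ∂μ) +
        3 * s ^ 2 * ∫ ω, {ω | T < |u ω|}.indicator (fun ω => u ω ^ 2) ω ∂μ := by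
  have hA : MeasurableSet {ω | T < |u ω|} := measurableSet_lt (by fun_prop) (by fun_prop)
  have hi1 : Integrable (fun ω => Complex.exp ((s * u ω : ℝ) * Complex.I)) μ := by
    refine Integrable.of_bound (C := 1) (by fun_prop) (Eventually.of_forall fun ω => ?_)
    rw [Complex.norm_exp_ofReal_mul_I]
  have hi2 : Integrable (fun ω => (((s * u ω : ℝ) : ℂ) * Complex.I)) μ :=
    ((h1.const_mul s).ofReal).mul_const _
  have hi3 : Integrable (fun ω => (((s * u ω : ℝ) : ℂ) ^ 2 / 2)) μ := by
    have : Integrable (fun ω => ((s ^ 2 / 2 * u ω ^ 2 : ℝ) : ℂ)) μ :=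
      (h2.const_mul (s ^ 2 / 2)).ofReal
    refine this.congr (Eventually.of_forall fun ω => ?_)
    simp only
    push_cast
    ring
  have hi4 : Integrable (fun _ : Ω => (1 : ℂ)) μ := integrable_const _
  have e1 : charFun (μ.map u) s = ∫ ω, Complex.exp ((s * u ω : ℝ) * Complex.I) ∂μ := by
    rw [charFun_apply_real, integral_map hu.aemeasurable (by fun_prop)]
    simp only [Complex.ofReal_mul]
  have e2 : charFun (μ.map u) s - ((1 - s ^ 2 * (∫ ω, u ω ^ 2 ∂μ) / 2 : ℝ) : ℂ) =
      ∫ ω, (Complex.exp ((s * u ω : ℝ) * Complex.I) -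
        (1 + (s * u ω : ℝ) * Complex.I - ((s * u ω : ℝ) : ℂ) ^ 2 / 2)) ∂μ := by
    have hi5 : Integrable (fun ω => (1 : ℂ) + (s * u ω : ℝ) * Complex.I) μ := hi4.add hi2
    have hi6 : Integrable (fun ω => (1 : ℂ) + (s * u ω : ℝ) * Complex.I -
      ((s * u ω : ℝ) : ℂ) ^ 2 / 2) μ := hi5.sub hi3
    rw [integral_sub hi1 hi6, integral_sub hi5 hi3,
      integral_add hi4 hi2, ← e1]
    have e3 : ∫ ω, (((s * u ω : ℝ) : ℂ) * Complex.I) ∂μ = 0 := by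
      rw [integral_mul_const, integral_complex_ofReal, integral_const_mul, h0]
      simp
    have e4 : ∫ ω, (((s * u ω : ℝ) : ℂ) ^ 2 / 2) ∂μ =
        ((s ^ 2 * (∫ ω, u ω ^ 2 ∂μ) / 2 : ℝ) : ℂ) := by
      rw [mul_div_right_comm, ← integral_const_mul, ← integral_complex_ofReal]
      congr 1
      ext ω
      push_cast
      ring
    rw [e3, e4]
    simp
  rw [e2, ← integral_const_mul, ← integral_const_mul,
    ← integral_add (h2.const_mul _) ((h2.indicator hA).const_mul _)]
  refine norm_integral_le_of_norm_le ((h2.const_mul _).add ((h2.indicator hA).const_mul _))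
    (Eventually.of_forall fun ω => ?_)
  have hb := norm_exp_mul_I_sub_le (s * u ω)
  by_cases hω : T < |u ω|
  · rw [Set.indicator_of_mem (show ω ∈ {ω | T < |u ω|} from hω)]
    refine hb.2.trans ?_
    have : 0 ≤ |s| ^ 3 * T * u ω ^ 2 := by positivity
    nlinarith
  · rw [Set.indicator_of_notMem (show ω ∉ {ω | T < |u ω|} from hω)]
    refine hb.1.trans ?_
    have h3 : |u ω| ^ 3 ≤ T * u ω ^ 2 := by
      rw [← sq_abs (u ω), pow_succ']
      exact mul_le_mul_of_nonneg_right (not_lt.1 hω) (by positivity)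
    rw [abs_mul, mul_pow, mul_zero, add_zero, mul_assoc]
    gcongr

/-- A quantitative central limit theorem for characteristic functions of weighted sums, normalized
to unit variance, in terms of the largest weight and of a bound on the truncated variances. -/
lemma norm_charFun_sum_sub_le {ι : Type*} [Fintype ι] {u : ι → Ω → ℝ} (hu : ∀ i, Measurable (u i))
    (hind : iIndepFun u μ) (h1 : ∀ i, Integrable (u i) μ) (h0 : ∀ i, ∫ ω, u i ω ∂μ = 0)
    (h2 : ∀ i, Integrable (fun ω => u i ω ^ 2) μ) {K : ℝ} (hK : 0 < K)
    (hl : ∀ i, 1 / K ≤ ∫ ω, u i ω ^ 2 ∂μ) (hup : ∀ i, ∫ ω, u i ω ^ 2 ∂μ ≤ K)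
    {T τ : ℝ} (hT : 0 ≤ T)
    (htail : ∀ i, ∫ ω, {ω | T < |u i ω|}.indicator (fun ω => u i ω ^ 2) ω ∂μ ≤ τ)
    {c : ι → ℝ} (hc : ∑ i, c i ^ 2 * ∫ ω, u i ω ^ 2 ∂μ = 1) {ε : ℝ} (hε : ∀ i, |c i| ≤ ε) (t : ℝ) :
    ‖charFun (μ.map fun ω => ∑ i, c i * u i ω) t - ((Real.exp (-(t ^ 2 / 2)) : ℝ) : ℂ)‖ ≤
      |t| ^ 3 * T * ε + 3 * t ^ 2 * K * τ + t ^ 4 * K * ε ^ 2 := by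
  set v : ι → ℝ := fun i => ∫ ω, u i ω ^ 2 ∂μ with hv
  have hv0 : ∀ i, 0 ≤ v i := fun i => integral_nonneg fun ω => sq_nonneg _
  have e1 : charFun (μ.map fun ω => ∑ i, c i * u i ω) t =
      ∏ i, charFun (μ.map (u i)) (c i * t) := by
    have hind' : iIndepFun (fun i ω => c i * u i ω) μ :=
      hind.comp (fun i x => c i * x) (fun i => by fun_prop)
    rw [hind'.charFun_map_fun_sum_eq_prod (fun i => by fun_prop)]
    rw [Finset.prod_apply]
    refine Finset.prod_congr rfl fun i _ => ?_
    rw [charFun_map_mul_comp (hu i).aemeasurable]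
  have e2 : ((Real.exp (-(t ^ 2 / 2)) : ℝ) : ℂ) =
      ∏ i, ((Real.exp (-((c i * t) ^ 2 * v i / 2)) : ℝ) : ℂ) := by
    rw [← Complex.ofReal_prod, ← Real.exp_sum]
    congr 2
    rw [Finset.sum_neg_distrib, ← Finset.sum_div]
    congr 2
    calc t ^ 2 = t ^ 2 * ∑ i, c i ^ 2 * v i := by rw [hc, mul_one]
      _ = _ := by
        rw [Finset.mul_sum]
        exact Finset.sum_congr rfl fun i _ => by ring
  rw [e1, e2]
  have hp : ∀ i, IsProbabilityMeasure (μ.map (u i)) := fun i =>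
    Measure.isProbabilityMeasure_map (hu i).aemeasurable
  refine (norm_prod_sub_prod_le _ _ _ (fun i => norm_charFun_le_one _) fun i => ?_).trans ?_
  · rw [Complex.norm_real, Real.norm_eq_abs, abs_of_pos (Real.exp_pos _), Real.exp_le_one_iff]
    have := hv0 i
    have : 0 ≤ (c i * t) ^ 2 * v i / 2 := by positivity
    linarith
  -- each factor contributes in proportion to its share `c i ^ 2 * v i` of the total variance `1`
  have key : ∀ i, ‖charFun (μ.map (u i)) (c i * t) -
      ((Real.exp (-((c i * t) ^ 2 * v i / 2)) : ℝ) : ℂ)‖ ≤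
      (|t| ^ 3 * T * ε + 3 * t ^ 2 * K * τ + t ^ 4 * K * ε ^ 2) * (c i ^ 2 * v i) := by
    intro i
    have a1 := norm_charFun_sub_le (hu i) (h1 i) (h0 i) (h2 i) T hT (c i * t)
    have hvi := hv0 i
    have a2 := abs_exp_neg_sub_le (x := (c i * t) ^ 2 * v i / 2) (by positivity)
    have a3 : ‖((1 - (c i * t) ^ 2 * v i / 2 : ℝ) : ℂ) -
        ((Real.exp (-((c i * t) ^ 2 * v i / 2)) : ℝ) : ℂ)‖ ≤ ((c i * t) ^ 2 * v i / 2) ^ 2 := by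
      rw [← Complex.ofReal_sub, Complex.norm_real, Real.norm_eq_abs, abs_sub_comm]
      exact a2
    refine (norm_sub_le_norm_sub_add_norm_sub _ _ _).trans ((add_le_add a1 a3).trans ?_)
    have hτ := htail i
    have hτ0 : 0 ≤ τ := le_trans (integral_nonneg fun ω =>
      Set.indicator_nonneg (fun _ _ => sq_nonneg _) _) hτ
    have hε0 : 0 ≤ ε := (abs_nonneg _).trans (hε i)
    have hKv : 1 ≤ K * v i := by
      have := hl i
      rwa [div_le_iff₀' hK] at this
    have hc2 : c i ^ 2 ≤ ε ^ 2 := by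
      rw [← sq_abs]
      exact pow_le_pow_left₀ (abs_nonneg _) (hε i) 2
    have b1 : |c i * t| ^ 3 * T * v i ≤ |t| ^ 3 * T * ε * (c i ^ 2 * v i) := by
      calc |c i * t| ^ 3 * T * v i = |t| ^ 3 * T * |c i| * (c i ^ 2 * v i) := by
            rw [abs_mul, mul_pow, pow_succ |c i|, sq_abs]; ring
        _ ≤ _ := by gcongr; exact hε i
    have b2 : 3 * (c i * t) ^ 2 *
        ∫ ω, {ω | T < |u i ω|}.indicator (fun ω => u i ω ^ 2) ω ∂μ ≤
        3 * t ^ 2 * K * τ * (c i ^ 2 * v i) := by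
      calc _ ≤ 3 * (c i * t) ^ 2 * τ := by gcongr
        _ = 3 * (c i * t) ^ 2 * τ * 1 := (mul_one _).symm
        _ ≤ 3 * (c i * t) ^ 2 * τ * (K * v i) := by gcongr
        _ = _ := by ring
    have b3 : ((c i * t) ^ 2 * v i / 2) ^ 2 ≤ t ^ 4 * K * ε ^ 2 * (c i ^ 2 * v i) := by
      calc _ = t ^ 4 * (v i / 4) * c i ^ 2 * (c i ^ 2 * v i) := by ring
        _ ≤ t ^ 4 * K * ε ^ 2 * (c i ^ 2 * v i) := by
          gcongr
          linarith [hup i]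
    linarith
  refine (Finset.sum_le_sum fun i _ => key i).trans_eq ?_
  rw [← Finset.mul_sum, hc, mul_one]

end

/-- The family of arrays `u n i` has uniformly small truncated second moments. -/
def UniformlySquareIntegrable {Ω : ℕ → Type*} [∀ n, MeasurableSpace (Ω n)]
    (μ : (n : ℕ) → Measure (Ω n)) (u : (n : ℕ) → Fin n → Ω n → ℝ) : Prop :=
  ∀ τ : ℝ, 0 < τ → ∃ T : ℝ, 0 < T ∧ ∀ n i,
    ∫ ω, {ω | T < |u n i ω|}.indicator (fun ω => u n i ω ^ 2) ω ∂(μ n) ≤ τ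

/-- The central limit theorem for weighted sums of a triangular array, uniformly over intervals. -/
lemma eventually_coverProb_le_sum {Ω : ℕ → Type*} [∀ n, MeasurableSpace (Ω n)]
    {μ : (n : ℕ) → Measure (Ω n)} [∀ n, IsProbabilityMeasure (μ n)]
    {u : (n : ℕ) → Fin n → Ω n → ℝ} (hu : ∀ n i, Measurable (u n i))
    (hind : ∀ n, iIndepFun (u n) (μ n)) (h1 : ∀ n i, Integrable (u n i) (μ n))
    (h0 : ∀ n i, ∫ ω, u n i ω ∂(μ n) = 0)
    (h2 : ∀ n i, Integrable (fun ω => u n i ω ^ 2) (μ n)) {K : ℝ} (hK : 0 < K)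
    (hl : ∀ n i, 1 / K ≤ ∫ ω, u n i ω ^ 2 ∂(μ n)) (hup : ∀ n i, ∫ ω, u n i ω ^ 2 ∂(μ n) ≤ K)
    (hUI : UniformlySquareIntegrable μ u) {c : (n : ℕ) → Fin n → ℝ}
    (hc : ∀ᶠ n in atTop, ∑ i, c n i ^ 2 * ∫ ω, u n i ω ^ 2 ∂(μ n) = 1)
    (hmax : ∀ ε : ℝ, 0 < ε → ∀ᶠ n in atTop, ∀ i, |c n i| ≤ ε) {ε : ℝ} (hε : 0 < ε) :
    ∀ᶠ n in atTop, ∀ b l : ℝ,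
      coverProb b l ≤ (μ n).real {ω | |b + ∑ i, c n i * u n i ω| ≤ l} + ε := by
  have hm : ∀ n, Measurable fun ω => ∑ i, c n i * u n i ω := fun n => by fun_prop
  let P : ℕ → ProbabilityMeasure ℝ := fun n =>
    ⟨(μ n).map fun ω => ∑ i, c n i * u n i ω,
      Measure.isProbabilityMeasure_map (hm n).aemeasurable⟩
  have hP : Tendsto P atTop (𝓝 ⟨gaussianReal 0 1, inferInstance⟩) := by
    refine ProbabilityMeasure.tendsto_of_tendsto_charFun fun t => ?_
    have hg : charFun (gaussianReal 0 1) t = ((Real.exp (-(t ^ 2 / 2)) : ℝ) : ℂ) := by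
      rw [charFun_gaussianReal]
      push_cast
      congr 1
      ring
    change Tendsto (fun n => charFun ((μ n).map fun ω => ∑ i, c n i * u n i ω) t) atTop
      (𝓝 (charFun (gaussianReal 0 1) t))
    rw [hg, Metric.tendsto_nhds]
    intro δ hδ
    obtain ⟨T, hT, htail⟩ := hUI (δ / (4 * (3 * t ^ 2 * K + 1))) (by positivity)
    have hcont : Tendsto (fun e : ℝ => |t| ^ 3 * T * e + t ^ 4 * K * e ^ 2) (𝓝[>] 0) (𝓝 0) := by
      have : Continuous fun e : ℝ => |t| ^ 3 * T * e + t ^ 4 * K * e ^ 2 := by fun_prop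
      have := (this.tendsto 0).mono_left (nhdsWithin_le_nhds (s := Set.Ioi 0))
      simpa using this
    obtain ⟨e, he, hepos⟩ := ((hcont.eventually (gt_mem_nhds (half_pos hδ))).and
      self_mem_nhdsWithin).exists
    filter_upwards [hc, hmax e hepos] with n hcn hen
    rw [dist_eq_norm]
    refine (norm_charFun_sum_sub_le (hu n) (hind n) (h1 n) (h0 n) (h2 n) hK (hl n) (hup n) hT.le
      (htail n) hcn hen t).trans_lt ?_
    have h3 : 3 * t ^ 2 * K * (δ / (4 * (3 * t ^ 2 * K + 1))) ≤ δ / 4 := by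
      rw [mul_div_assoc', div_le_div_iff₀ (by positivity) (by positivity)]
      nlinarith [show 0 ≤ 3 * t ^ 2 * K by positivity]
    linarith
  filter_upwards [eventually_coverProb_le hP hε] with n hn b l
  refine (hn b l).trans_eq ?_
  change ((μ n).map fun ω => ∑ i, c n i * u n i ω).real {z | |b + z| ≤ l} + ε = _
  rw [map_measureReal_apply (hm n) (measurableSet_abs_add_le _ _)]
  rfl

/-! ### Laws of large numbers in mean for quadratic forms -/

lemma memLp_two_of_integrable_sq {Ω : Type*} [MeasurableSpace Ω] {μ : Measure Ω} {X : Ω → ℝ}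
    (hX : Measurable X) (h : Integrable (fun ω => X ω ^ 2) μ) : MemLp X 2 μ :=
  (memLp_two_iff_integrable_sq hX.aestronglyMeasurable).2 h

lemma integral_mul_mul_mul_eq_zero {Ω ι : Type*} [MeasurableSpace Ω] {μ : Measure Ω} {u : ι → Ω → ℝ}
    (hu : ∀ i, Measurable (u i)) (hind : iIndepFun u μ)
    (h0 : ∀ i, ∫ ω, u i ω ∂μ = 0) {m a b c : ι} (ha : m ≠ a) (hb : m ≠ b) (hc : m ≠ c) :
    ∫ ω, u m ω * (u a ω * (u b ω * u c ω)) ∂μ = 0 := by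
  classical
  have h := hind.indepFun_finset {m} {a, b, c} (by simp [ha, hb, hc]) hu
  have h' : IndepFun (u m) (fun ω => u a ω * (u b ω * u c ω)) μ :=
    h.comp (φ := fun x : ({m} : Finset ι) → ℝ => x ⟨m, by simp⟩)
      (ψ := fun x : ({a, b, c} : Finset ι) → ℝ => x ⟨a, by simp⟩ * (x ⟨b, by simp⟩ * x ⟨c, by simp⟩))
      (by fun_prop) (by fun_prop)
  rw [h'.integral_fun_mul_eq_mul_integral (hu m).aestronglyMeasurable
    (by fun_prop), h0, zero_mul]

section
variable {Ω : Type*} [MeasurableSpace Ω] {μ : Measure Ω} [IsProbabilityMeasure μ]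
  {ι : Type*} [Fintype ι] {u : ι → Ω → ℝ}

lemma integral_abs_le_sqrt {X : Ω → ℝ} (hX : MemLp X 2 μ) :
    ∫ ω, |X ω| ∂μ ≤ √(∫ ω, X ω ^ 2 ∂μ) := by
  apply Real.le_sqrt_of_sq_le
  have h := variance_nonneg |X| μ
  rw [variance_eq_sub hX.abs] at h
  simp only [Pi.pow_apply, Pi.abs_apply, sq_abs] at h
  linarith

/-- A weak law of large numbers for squares in `L¹`, with explicit constants: only truncated second
moments enter, so that no fourth moments are needed. -/
lemma integral_abs_sum_sq_sub_le (hu : ∀ i, Measurable (u i)) (hind : iIndepFun u μ)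
    (h2 : ∀ i, Integrable (fun ω => u i ω ^ 2) μ) {T τ : ℝ} (hτ : 0 ≤ τ)
    (htail : ∀ i, ∫ ω, {ω | T < |u i ω|}.indicator (fun ω => u i ω ^ 2) ω ∂μ ≤ τ)
    {w : ι → ℝ} (hw : ∀ i, 0 ≤ w i) {θ W : ℝ} (hθ0 : 0 ≤ θ) (hθ : ∀ i, w i ≤ θ)
    (hW : ∑ i, w i ≤ W) :
    ∫ ω, |∑ i, w i * (u i ω ^ 2 - ∫ ω', u i ω' ^ 2 ∂μ)| ∂μ ≤ T ^ 2 * √(θ * W) + 2 * W * τ := by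
  have hA : ∀ i, MeasurableSet {ω | T < |u i ω|} := fun i =>
    measurableSet_lt (by fun_prop) (by fun_prop)
  -- split each square into a part bounded by `T ^ 2`, for which the variance is used, and a tail
  -- `r i`, which is small in `L¹`
  set r : ι → Ω → ℝ := fun i => {ω | T < |u i ω|}.indicator (fun ω => u i ω ^ 2) with hr
  set φ : ℝ → ℝ := {x : ℝ | |x| ≤ T}.indicator (fun x => x ^ 2) with hφ
  have hφm : Measurable φ :=
    Measurable.indicator (by fun_prop) (measurableSet_le (by fun_prop) (by fun_prop))
  have hφ0 : ∀ x, 0 ≤ φ x := fun x => Set.indicator_nonneg (fun _ _ => sq_nonneg _) _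
  have hφT : ∀ x, φ x ≤ T ^ 2 := by
    intro x
    by_cases hx : |x| ≤ T
    · rw [hφ, Set.indicator_of_mem (show x ∈ {x : ℝ | |x| ≤ T} from hx), ← sq_abs]
      exact pow_le_pow_left₀ (abs_nonneg _) hx 2
    · rw [hφ, Set.indicator_of_notMem (show x ∉ {x : ℝ | |x| ≤ T} from hx)]
      positivity
  have hsplit : ∀ i ω, u i ω ^ 2 = φ (u i ω) + r i ω := by
    intro i ω
    by_cases hx : |u i ω| ≤ T
    · rw [hφ, hr, Set.indicator_of_mem (show u i ω ∈ {x : ℝ | |x| ≤ T} from hx)]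
      simp only
      rw [Set.indicator_of_notMem (by simpa using hx), add_zero]
    · rw [hφ, hr, Set.indicator_of_notMem (show u i ω ∉ {x : ℝ | |x| ≤ T} from hx)]
      simp only
      rw [Set.indicator_of_mem (by simpa using hx), zero_add]
  have hri : ∀ i, Integrable (r i) μ := fun i => (h2 i).indicator (hA i)
  have hr0 : ∀ i ω, 0 ≤ r i ω := fun i ω => Set.indicator_nonneg (fun _ _ => sq_nonneg _) _
  have hφL : ∀ i, MemLp (fun ω => w i * φ (u i ω)) 2 μ := fun i =>
    (MemLp.of_bound (C := T ^ 2) (hφm.comp (hu i)).aestronglyMeasurable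
      (Eventually.of_forall fun ω => by
        exact (abs_of_nonneg (hφ0 _)).trans_le (hφT _))).const_mul (w i)
  have hφi : ∀ i, Integrable (fun ω => φ (u i ω)) μ := fun i =>
    Integrable.of_bound (C := T ^ 2) (hφm.comp (hu i)).aestronglyMeasurable
      (Eventually.of_forall fun ω => by
        exact (abs_of_nonneg (hφ0 _)).trans_le (hφT _))
  set Y : Ω → ℝ := fun ω => ∑ i, w i * φ (u i ω) with hY
  have hYL : MemLp Y 2 μ := memLp_finsetSum _ fun i _ => hφL i
  have hYint : ∫ ω, Y ω ∂μ = ∑ i, w i * ∫ ω, φ (u i ω) ∂μ := by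
    rw [hY, integral_finsetSum _ fun i _ => (hφi i).const_mul _]
    simp only [integral_const_mul]
  have hvar : Var[Y; μ] ≤ T ^ 4 * (θ * W) := by
    have e : Y = ∑ i, fun ω => w i * φ (u i ω) := by
      ext ω
      simp [hY]
    rw [e, IndepFun.variance_sum (fun i _ => hφL i)]
    · calc ∑ i, Var[fun ω => w i * φ (u i ω); μ] ≤ ∑ i, θ * w i * T ^ 4 := by
            refine Finset.sum_le_sum fun i _ => ?_
            refine (variance_le_expectation_sq (hφL i).1).trans ?_
            calc ∫ ω, ((fun ω => w i * φ (u i ω)) ^ 2) ω ∂μ ≤ ∫ _, θ * w i * T ^ 4 ∂μ := by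
                  refine integral_mono (hφL i).integrable_sq (integrable_const _) fun ω => ?_
                  simp only [Pi.pow_apply]
                  have a := hφ0 (u i ω)
                  have b := hφT (u i ω)
                  have c := hw i
                  calc (w i * φ (u i ω)) ^ 2 = w i * w i * φ (u i ω) ^ 2 := by ring
                    _ ≤ θ * w i * (T ^ 2) ^ 2 := by gcongr; exact hθ i
                    _ = _ := by ring
              _ = _ := by simp
        _ = T ^ 4 * θ * ∑ i, w i := by
            rw [Finset.mul_sum]
            exact Finset.sum_congr rfl fun i _ => by ring
        _ ≤ T ^ 4 * (θ * W) := by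
            rw [mul_assoc]
            gcongr
    · intro i _ j _ hij
      exact (hind.indepFun hij).comp (φ := fun x => w i * φ x) (ψ := fun x => w j * φ x)
        (by fun_prop) (by fun_prop)
  have hmain : ∫ ω, |Y ω - ∫ ω', Y ω' ∂μ| ∂μ ≤ T ^ 2 * √(θ * W) := by
    refine (integral_abs_le_sqrt (hYL.sub (memLp_const _))).trans ?_
    have : ∫ ω, (Y ω - ∫ ω', Y ω' ∂μ) ^ 2 ∂μ = Var[Y; μ] :=
      (variance_eq_integral hYL.1.aemeasurable).symm
    simp only [Pi.sub_apply]
    rw [this]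
    refine (Real.sqrt_le_sqrt hvar).trans_eq ?_
    rw [Real.sqrt_mul (by positivity), show T ^ 4 = (T ^ 2) ^ 2 by ring,
      Real.sqrt_sq (by positivity)]
  have hrsum : ∑ i, w i * ∫ ω, r i ω ∂μ ≤ W * τ := by
    calc _ ≤ ∑ i, w i * τ := Finset.sum_le_sum fun i _ =>
          mul_le_mul_of_nonneg_left (htail i) (hw i)
      _ ≤ W * τ := by
          rw [← Finset.sum_mul]
          gcongr
  have hpt : ∀ ω, |∑ i, w i * (u i ω ^ 2 - ∫ ω', u i ω' ^ 2 ∂μ)| ≤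
      |Y ω - ∫ ω', Y ω' ∂μ| + (∑ i, w i * r i ω + ∑ i, w i * ∫ ω', r i ω' ∂μ) := by
    intro ω
    have e : ∑ i, w i * (u i ω ^ 2 - ∫ ω', u i ω' ^ 2 ∂μ) =
        (Y ω - ∫ ω', Y ω' ∂μ) + (∑ i, w i * r i ω - ∑ i, w i * ∫ ω', r i ω' ∂μ) := by
      rw [hYint, hY, ← Finset.sum_sub_distrib, ← Finset.sum_sub_distrib, ← Finset.sum_add_distrib]
      refine Finset.sum_congr rfl fun i _ => ?_
      have : ∫ ω', u i ω' ^ 2 ∂μ = ∫ ω', φ (u i ω') ∂μ + ∫ ω', r i ω' ∂μ := by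
        rw [← integral_add (hφi i) (hri i)]
        simp only [hsplit]
      rw [this, hsplit]
      ring
    rw [e]
    refine (abs_add_le _ _).trans (add_le_add le_rfl ((abs_sub _ _).trans ?_))
    rw [abs_of_nonneg (Finset.sum_nonneg fun i _ => mul_nonneg (hw i) (hr0 i ω)),
      abs_of_nonneg (Finset.sum_nonneg fun i _ => mul_nonneg (hw i) (integral_nonneg (hr0 i)))]
  have hYsub : Integrable (fun ω => |Y ω - ∫ ω', Y ω' ∂μ|) μ :=
    ((hYL.integrable (by norm_num)).sub (integrable_const _)).abs
  have hrs : Integrable (fun ω => ∑ i, w i * r i ω) μ :=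
    integrable_finsetSum _ fun i _ => (hri i).const_mul _
  have hrs' : Integrable (fun ω => ∑ i, w i * r i ω + ∑ i, w i * ∫ ω', r i ω' ∂μ) μ :=
    hrs.add (integrable_const _)
  refine (integral_mono_of_nonneg (Eventually.of_forall fun _ => abs_nonneg _)
    (hYsub.add hrs') (Eventually.of_forall hpt)).trans ?_
  simp only [Pi.add_apply]
  rw [integral_add hYsub hrs', integral_add hrs (integrable_const _),
    integral_finsetSum _ fun i _ => (hri i).const_mul _]
  simp only [integral_const_mul, integral_const, probReal_univ, one_smul]
  linarith

/-- An off-diagonal quadratic form in independent centered variables has second moment at most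
`2 K²` times the sum of its squared coefficients: products over different unordered pairs are
uncorrelated. -/
lemma integral_abs_offDiag_le [DecidableEq ι] (hu : ∀ i, Measurable (u i)) (hind : iIndepFun u μ)
    (h0 : ∀ i, ∫ ω, u i ω ∂μ = 0)
    (h2 : ∀ i, Integrable (fun ω => u i ω ^ 2) μ) {K : ℝ}
    (hup : ∀ i, ∫ ω, u i ω ^ 2 ∂μ ≤ K) (A : ι × ι → ℝ) :
    ∫ ω, |∑ p ∈ Finset.univ.offDiag, A p * (u p.1 ω * u p.2 ω)| ∂μ ≤
      √(2 * K ^ 2 * ∑ p ∈ Finset.univ.offDiag, A p ^ 2) := by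
  have hV : ∀ p ∈ (Finset.univ : Finset ι).offDiag, Integrable (fun ω => (u p.1 ω * u p.2 ω) ^ 2) μ ∧
      ∫ ω, (u p.1 ω * u p.2 ω) ^ 2 ∂μ ≤ K ^ 2 := by
    intro p hp
    have hne := (Finset.mem_offDiag.1 hp).2.2
    have hi : IndepFun (fun ω => u p.1 ω ^ 2) (fun ω => u p.2 ω ^ 2) μ :=
      (hind.indepFun hne).comp (φ := fun x => x ^ 2) (ψ := fun x => x ^ 2)
        (by fun_prop) (by fun_prop)
    simp only [mul_pow]
    refine ⟨hi.integrable_mul (h2 _) (h2 _), ?_⟩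
    rw [hi.integral_fun_mul_eq_mul_integral (h2 _).1 (h2 _).1, sq K]
    exact mul_le_mul (hup _) (hup _) (integral_nonneg fun _ => sq_nonneg _)
      ((integral_nonneg fun _ => sq_nonneg _).trans (hup p.1))
  have hVL : ∀ p ∈ (Finset.univ : Finset ι).offDiag, MemLp (fun ω => u p.1 ω * u p.2 ω) 2 μ :=
    fun p hp => memLp_two_of_integrable_sq (by fun_prop) (hV p hp).1
  set E : ι × ι → ι × ι → ℝ := fun p q => ∫ ω, (u p.1 ω * u p.2 ω) * (u q.1 ω * u q.2 ω) ∂μ with hE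
  -- for `q` other than `p` and `p.swap` some index occurs exactly once among the four
  have hEb : ∀ p ∈ (Finset.univ : Finset ι).offDiag, ∀ q ∈ (Finset.univ : Finset ι).offDiag,
      |E p q| ≤ (if q = p then K ^ 2 else 0) + (if q = p.swap then K ^ 2 else 0) := by
    intro p hp q hq
    have hpn := (Finset.mem_offDiag.1 hp).2.2
    have hqn := (Finset.mem_offDiag.1 hq).2.2
    obtain ⟨i, j⟩ := p
    obtain ⟨k, l⟩ := q
    have hdiag : |∫ ω, (u i ω * u j ω) ^ 2 ∂μ| ≤ K ^ 2 := by
      rw [abs_of_nonneg (integral_nonneg fun _ => sq_nonneg _)]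
      exact (hV _ hp).2
    simp only [hE, Prod.mk.injEq, Prod.swap_prod_mk] at hpn hqn ⊢
    have hK2 := sq_nonneg K
    by_cases h1 : k = i ∧ l = j
    · obtain ⟨rfl, rfl⟩ := h1
      simp only [← sq]
      simp only [and_self, if_true]
      split_ifs <;> linarith
    by_cases h3 : k = j ∧ l = i
    · obtain ⟨rfl, rfl⟩ := h3
      rw [if_neg h1]
      simp only [and_self, if_true, zero_add]
      convert hdiag using 3
      ext ω
      ring
    · rw [if_neg h1, if_neg h3, add_zero]
      refine le_of_eq (abs_eq_zero.2 ?_)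
      by_cases h4 : i = k ∨ i = l
      · have h5 : j ≠ k ∧ j ≠ l := by grind
        rw [← integral_mul_mul_mul_eq_zero hu hind h0 (Ne.symm hpn) h5.1 h5.2]
        congr 1
        ext ω
        ring
      · rw [not_or] at h4
        rw [← integral_mul_mul_mul_eq_zero hu hind h0 hpn h4.1 h4.2]
        congr 1
        ext ω
        ring
  have hQL : MemLp (fun ω => ∑ p ∈ Finset.univ.offDiag, A p * (u p.1 ω * u p.2 ω)) 2 μ :=
    memLp_finsetSum _ fun p hp => (hVL p hp).const_mul _
  refine (integral_abs_le_sqrt hQL).trans (Real.sqrt_le_sqrt ?_)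
  have e1 : ∫ ω, (∑ p ∈ Finset.univ.offDiag, A p * (u p.1 ω * u p.2 ω)) ^ 2 ∂μ =
      ∑ p ∈ Finset.univ.offDiag, ∑ q ∈ Finset.univ.offDiag, A p * A q * E p q := by
    have hpq : ∀ p ∈ (Finset.univ : Finset ι).offDiag, ∀ q ∈ (Finset.univ : Finset ι).offDiag,
        Integrable (fun ω => A p * A q * ((u p.1 ω * u p.2 ω) * (u q.1 ω * u q.2 ω))) μ :=
      fun p hp q hq => ((hVL p hp).integrable_mul (hVL q hq)).const_mul _
    simp only [sq, Finset.sum_mul_sum]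
    rw [integral_finsetSum _ fun p hp => integrable_finsetSum _ fun q hq =>
      (hpq p hp q hq).congr (Eventually.of_forall fun ω => by simp only; ring)]
    refine Finset.sum_congr rfl fun p hp => ?_
    rw [integral_finsetSum _ fun q hq =>
      (hpq p hp q hq).congr (Eventually.of_forall fun ω => by simp only; ring)]
    refine Finset.sum_congr rfl fun q hq => ?_
    rw [hE, ← integral_const_mul]
    congr 1
    ext ω
    ring
  have hsymm : ∀ p q, E p q = E q p := fun p q => by
    simp only [hE]
    congr 1
    ext ω
    ring
  rw [e1]
  calc ∑ p ∈ Finset.univ.offDiag, ∑ q ∈ Finset.univ.offDiag, A p * A q * E p q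
      ≤ ∑ p ∈ Finset.univ.offDiag, ∑ q ∈ Finset.univ.offDiag,
        (A p ^ 2 * |E p q| / 2 + A q ^ 2 * |E q p| / 2) := by
        refine Finset.sum_le_sum fun p _ => Finset.sum_le_sum fun q _ => ?_
        rw [← hsymm p q]
        refine (le_abs_self _).trans ?_
        rw [abs_mul]
        have : |A p * A q| ≤ (A p ^ 2 + A q ^ 2) / 2 := by
          rw [abs_le]
          constructor <;> nlinarith [sq_nonneg (A p + A q), sq_nonneg (A p - A q)]
        nlinarith [abs_nonneg (E p q)]
    _ = ∑ p ∈ Finset.univ.offDiag, ∑ q ∈ Finset.univ.offDiag, A p ^ 2 * |E p q| := by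
        simp only [Finset.sum_add_distrib]
        rw [Finset.sum_comm (f := fun p q => A q ^ 2 * |E q p| / 2), ← Finset.sum_add_distrib]
        refine Finset.sum_congr rfl fun p _ => ?_
        rw [← Finset.sum_add_distrib]
        exact Finset.sum_congr rfl fun q _ => by ring
    _ ≤ ∑ p ∈ Finset.univ.offDiag, A p ^ 2 * (2 * K ^ 2) := by
        refine Finset.sum_le_sum fun p hp => ?_
        rw [← Finset.mul_sum]
        refine mul_le_mul_of_nonneg_left ?_ (sq_nonneg _)
        refine (Finset.sum_le_sum fun q hq => hEb p hp q hq).trans ?_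
        rw [Finset.sum_add_distrib, Finset.sum_ite_eq', Finset.sum_ite_eq']
        have := sq_nonneg K
        split_ifs <;> linarith
    _ = 2 * K ^ 2 * ∑ p ∈ Finset.univ.offDiag, A p ^ 2 := by
        rw [← Finset.sum_mul, mul_comm]

end

lemma memLp_sum_const_mul {Ω ι : Type*} [MeasurableSpace Ω] {μ : Measure Ω} {u : ι → Ω → ℝ}
    [Fintype ι] (hu : ∀ i, Measurable (u i))
    (h2 : ∀ i, Integrable (fun ω => u i ω ^ 2) μ) (c : ι → ℝ) :
    MemLp (fun ω => ∑ i, c i * u i ω) 2 μ :=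
  memLp_finsetSum _ fun i _ => (memLp_two_of_integrable_sq (hu i) (h2 i)).const_mul _

/-- Weighted averages of squares are stable in `L¹` under perturbations that are small in `L²`. -/
lemma integral_abs_sum_perturb_le {Ω ι : Type*} [MeasurableSpace Ω] {μ : Measure Ω}
    [Fintype ι] {X e : ι → Ω → ℝ}
    (hX : ∀ i, MemLp (X i) 2 μ)
    (he : ∀ i, MemLp (e i) 2 μ) {a ε l : ℝ} (ha : ∀ i, ∫ ω, X i ω ^ 2 ∂μ ≤ a)
    (hε : ∀ i, ∫ ω, e i ω ^ 2 ∂μ ≤ ε) (hl : 0 < l) {w : ι → ℝ} (hw : ∀ i, 0 ≤ w i)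
    (hw1 : ∑ i, w i = 1) :
    ∫ ω, |∑ i, w i * ((X i ω + e i ω) ^ 2 - X i ω ^ 2)| ∂μ ≤ l * a + (1 / l + 1) * ε := by
  have hi : ∀ i, Integrable (fun ω => l * X i ω ^ 2 + (1 / l + 1) * e i ω ^ 2) μ := fun i =>
    ((hX i).integrable_sq.const_mul _).add ((he i).integrable_sq.const_mul _)
  calc ∫ ω, |∑ i, w i * ((X i ω + e i ω) ^ 2 - X i ω ^ 2)| ∂μ
      ≤ ∫ ω, ∑ i, w i * (l * X i ω ^ 2 + (1 / l + 1) * e i ω ^ 2) ∂μ := by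
        refine integral_mono_of_nonneg (Eventually.of_forall fun _ => abs_nonneg _)
          (integrable_finsetSum _ fun i _ => (hi i).const_mul _) (Eventually.of_forall fun ω => ?_)
        refine (Finset.abs_sum_le_sum_abs _ _).trans (Finset.sum_le_sum fun i _ => ?_)
        rw [abs_mul, abs_of_nonneg (hw i)]
        refine mul_le_mul_of_nonneg_left ?_ (hw i)
        have h1 : 0 ≤ (l * X i ω - e i ω) ^ 2 / l := by positivity
        have h2 : 0 ≤ (l * X i ω + e i ω) ^ 2 / l := by positivity
        have h3 : (l * X i ω - e i ω) ^ 2 / l =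
          l * X i ω ^ 2 - 2 * X i ω * e i ω + 1 / l * e i ω ^ 2 := by field_simp; ring
        have h4 : (l * X i ω + e i ω) ^ 2 / l =
          l * X i ω ^ 2 + 2 * X i ω * e i ω + 1 / l * e i ω ^ 2 := by field_simp; ring
        rw [abs_le]
        constructor <;> nlinarith [sq_nonneg (e i ω)]
    _ = ∑ i, w i * (l * ∫ ω, X i ω ^ 2 ∂μ + (1 / l + 1) * ∫ ω, e i ω ^ 2 ∂μ) := by
        rw [integral_finsetSum _ fun i _ => (hi i).const_mul _]
        refine Finset.sum_congr rfl fun i _ => ?_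
        rw [integral_const_mul, integral_add ((hX i).integrable_sq.const_mul _)
          ((he i).integrable_sq.const_mul _), integral_const_mul, integral_const_mul]
    _ ≤ ∑ i, w i * (l * a + (1 / l + 1) * ε) := by
        refine Finset.sum_le_sum fun i _ => mul_le_mul_of_nonneg_left ?_ (hw i)
        gcongr
        · exact ha i
        · exact hε i
    _ = _ := by rw [← Finset.sum_mul, hw1, one_mul]

section
variable {Ω : Type*} [MeasurableSpace Ω] {μ : Measure Ω} [IsProbabilityMeasure μ]
  {ι : Type*} [Fintype ι] {u : ι → Ω → ℝ}

lemma integral_sum_const_mul_sq (hu : ∀ i, Measurable (u i)) (hind : iIndepFun u μ)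
    (h0 : ∀ i, ∫ ω, u i ω ∂μ = 0) (h2 : ∀ i, Integrable (fun ω => u i ω ^ 2) μ) (c : ι → ℝ) :
    ∫ ω, (∑ i, c i * u i ω) ^ 2 ∂μ = ∑ i, c i ^ 2 * ∫ ω, u i ω ^ 2 ∂μ := by
  have hL := fun i => memLp_two_of_integrable_sq (hu i) (h2 i)
  have hLc : ∀ i, MemLp (fun ω => c i * u i ω) 2 μ := fun i => (hL i).const_mul _
  have hm : ∫ ω, ∑ i, c i * u i ω ∂μ = 0 := by
    rw [integral_finsetSum _ fun i _ => (hLc i).integrable (by norm_num)]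
    simp [integral_const_mul, h0]
  have hv := IndepFun.variance_sum (s := Finset.univ) (fun i _ => hLc i) (fun i _ j _ hij =>
    (hind.indepFun hij).comp (φ := fun x => c i * x) (ψ := fun x => c j * x)
      (by fun_prop) (by fun_prop))
  have e : (∑ i, fun ω => c i * u i ω) = fun ω => ∑ i, c i * u i ω := by
    ext ω
    simp
  rw [e, variance_of_integral_eq_zero (by fun_prop) hm] at hv
  rw [hv]
  refine Finset.sum_congr rfl fun i _ => ?_
  rw [variance_of_integral_eq_zero (by fun_prop) (by rw [integral_const_mul, h0, mul_zero]),
    ← integral_const_mul]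
  simp only [mul_pow]

/-- A weighted average of squares of linear forms in independent errors is close in `L¹` to its
mean, if no single error has a large total influence on it. The diagonal of this quadratic form is
handled by the law of large numbers and the rest by orthogonality. -/
lemma integral_abs_sum_sq_linear_sub_le (hu : ∀ i, Measurable (u i)) (hind : iIndepFun u μ)
    (h0 : ∀ i, ∫ ω, u i ω ∂μ = 0) (h2 : ∀ i, Integrable (fun ω => u i ω ^ 2) μ)
    {K : ℝ} (hup : ∀ i, ∫ ω, u i ω ^ 2 ∂μ ≤ K) {T τ : ℝ} (hτ : 0 ≤ τ)
    (htail : ∀ i, ∫ ω, {ω | T < |u i ω|}.indicator (fun ω => u i ω ^ 2) ω ∂μ ≤ τ)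
    {w : ι → ℝ} (hw : ∀ i, 0 ≤ w i) (hw1 : ∑ i, w i = 1) {r : ι → ι → ℝ}
    (hr1 : ∀ m i, |r m i| ≤ 1) (hr2 : ∀ m, ∑ i, |r m i| ≤ 2) {θ : ℝ} (hθ0 : 0 ≤ θ)
    (hθ : ∀ i, ∑ m, w m * |r m i| ≤ θ) :
    ∫ ω, |∑ m, w m * ((∑ i, r m i * u i ω) ^ 2 - ∑ i, r m i ^ 2 * ∫ ω', u i ω' ^ 2 ∂μ)| ∂μ ≤
      T ^ 2 * √(θ * 2) + 2 * 2 * τ + √(2 * K ^ 2 * (θ * 4)) := by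
  classical
  -- `A` is the matrix of the quadratic form; its entries are at most `θ`, and at most `4` in total
  set A : ι × ι → ℝ := fun p => ∑ m, w m * (r m p.1 * r m p.2) with hA
  have hr0 := fun m i => abs_nonneg (r m i)
  have hdiag : ∀ m i, r m i ^ 2 ≤ |r m i| := fun m i => by
    rw [← sq_abs]
    nlinarith [hr1 m i, hr0 m i]
  have hAθ : ∀ p, |A p| ≤ θ := fun p => by
    refine (Finset.abs_sum_le_sum_abs _ _).trans ((Finset.sum_le_sum fun m _ => ?_).trans (hθ p.1))
    rw [abs_mul, abs_mul, abs_of_nonneg (hw m)]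
    exact mul_le_mul_of_nonneg_left (mul_le_of_le_one_right (hr0 _ _) (hr1 _ _)) (hw m)
  have hAsum : ∑ p, |A p| ≤ 4 := by
    calc ∑ p, |A p| ≤ ∑ p : ι × ι, ∑ m, w m * (|r m p.1| * |r m p.2|) := by
          refine Finset.sum_le_sum fun p _ => (Finset.abs_sum_le_sum_abs _ _).trans_eq ?_
          refine Finset.sum_congr rfl fun m _ => ?_
          rw [abs_mul, abs_mul, abs_of_nonneg (hw m)]
      _ = ∑ m, w m * ((∑ i, |r m i|) * ∑ j, |r m j|) := by
          rw [Finset.sum_comm]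
          refine Finset.sum_congr rfl fun m _ => ?_
          rw [← Finset.mul_sum, Finset.sum_mul_sum, ← Finset.univ_product_univ,
            Finset.sum_product]
      _ ≤ ∑ m, w m * (2 * 2) := by
          refine Finset.sum_le_sum fun m _ => mul_le_mul_of_nonneg_left ?_ (hw m)
          have := Finset.sum_nonneg fun i (_ : i ∈ Finset.univ) => hr0 m i
          gcongr <;> exact hr2 m
      _ = 4 := by rw [← Finset.sum_mul, hw1]; norm_num
  have hAsq : ∑ p ∈ Finset.univ.offDiag, A p ^ 2 ≤ θ * 4 := by
    calc ∑ p ∈ Finset.univ.offDiag, A p ^ 2 ≤ ∑ p, A p ^ 2 :=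
          Finset.sum_le_sum_of_subset_of_nonneg (Finset.subset_univ _) fun _ _ _ => sq_nonneg _
      _ ≤ ∑ p, θ * |A p| := by
          refine Finset.sum_le_sum fun p _ => ?_
          rw [← sq_abs, sq]
          exact mul_le_mul_of_nonneg_right (hAθ p) (abs_nonneg _)
      _ ≤ θ * 4 := by
          rw [← Finset.mul_sum]
          gcongr
  have hAii : ∀ i, A (i, i) = ∑ m, w m * r m i ^ 2 := fun i => by simp only [hA, sq]
  have hAii0 : ∀ i, 0 ≤ A (i, i) := fun i => by
    rw [hAii]
    exact Finset.sum_nonneg fun m _ => mul_nonneg (hw m) (sq_nonneg _)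
  have hAtr : ∑ i, A (i, i) ≤ 2 := by
    calc ∑ i, A (i, i) = ∑ m, w m * ∑ i, r m i ^ 2 := by
          simp only [hAii, Finset.mul_sum]
          exact Finset.sum_comm
      _ ≤ ∑ m, w m * 2 := Finset.sum_le_sum fun m _ => mul_le_mul_of_nonneg_left
          ((Finset.sum_le_sum fun i _ => hdiag m i).trans (hr2 m)) (hw m)
      _ = 2 := by rw [← Finset.sum_mul, hw1, one_mul]
  have b1 := integral_abs_sum_sq_sub_le hu hind h2 hτ htail hAii0 hθ0
    (fun i => (le_abs_self _).trans (hAθ (i, i))) hAtr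
  have b2 := integral_abs_offDiag_le hu hind h0 h2 hup A
  have hpt : ∀ ω, ∑ m, w m * ((∑ i, r m i * u i ω) ^ 2 - ∑ i, r m i ^ 2 * ∫ ω', u i ω' ^ 2 ∂μ) =
      ∑ i, A (i, i) * (u i ω ^ 2 - ∫ ω', u i ω' ^ 2 ∂μ) +
        ∑ p ∈ Finset.univ.offDiag, A p * (u p.1 ω * u p.2 ω) := by
    intro ω
    have e1 : ∑ p : ι × ι, A p * (u p.1 ω * u p.2 ω) =
        ∑ i, A (i, i) * u i ω ^ 2 + ∑ p ∈ Finset.univ.offDiag, A p * (u p.1 ω * u p.2 ω) := by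
      rw [← Finset.univ_product_univ, ← Finset.diag_union_offDiag,
        Finset.sum_union (Finset.disjoint_diag_offDiag _), Finset.sum_diag]
      simp only [sq]
    have e2 : ∑ p : ι × ι, A p * (u p.1 ω * u p.2 ω) = ∑ m, w m * (∑ i, r m i * u i ω) ^ 2 := by
      simp only [hA, Finset.sum_mul]
      rw [Finset.sum_comm]
      refine Finset.sum_congr rfl fun m _ => ?_
      rw [sq, Finset.sum_mul_sum, ← Finset.univ_product_univ, Finset.sum_product, Finset.mul_sum]
      refine Finset.sum_congr rfl fun i _ => ?_
      rw [Finset.mul_sum]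
      exact Finset.sum_congr rfl fun j _ => by ring
    have e3 : ∑ i, A (i, i) * ∫ ω', u i ω' ^ 2 ∂μ =
        ∑ m, w m * ∑ i, r m i ^ 2 * ∫ ω', u i ω' ^ 2 ∂μ := by
      simp only [hAii, Finset.sum_mul, Finset.mul_sum]
      rw [Finset.sum_comm]
      exact Finset.sum_congr rfl fun m _ => Finset.sum_congr rfl fun i _ => by ring
    simp only [mul_sub, Finset.sum_sub_distrib]
    rw [e3, ← e2, e1]
    ring
  have i1 : Integrable (fun ω => |∑ i, A (i, i) * (u i ω ^ 2 - ∫ ω', u i ω' ^ 2 ∂μ)|) μ :=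
    (integrable_finsetSum _ fun i _ => ((h2 i).sub (integrable_const _)).const_mul _).abs
  have i2 : Integrable (fun ω => |∑ p ∈ Finset.univ.offDiag, A p * (u p.1 ω * u p.2 ω)|) μ :=
    (integrable_finsetSum _ fun p _ => ((memLp_two_of_integrable_sq (hu _) (h2 _)).integrable_mul
      (memLp_two_of_integrable_sq (hu _) (h2 _))).const_mul _).abs
  simp only [hpt]
  refine (integral_mono_of_nonneg (Eventually.of_forall fun _ => abs_nonneg _) (i1.add i2)
    (Eventually.of_forall fun ω => abs_add_le _ _)).trans ?_
  rw [integral_add' i1 i2]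
  refine add_le_add b1 (b2.trans (Real.sqrt_le_sqrt ?_))
  gcongr

end

/-! ### Coverage from consistent standard errors -/

lemma abs_sqrt_sub_one_le (q : ℝ) : |√q - 1| ≤ |q - 1| := by
  rcases le_total 0 q with h | h
  · have h1 : q - 1 = (√q - 1) * (√q + 1) := by
      have := Real.mul_self_sqrt h
      linarith
    have h2 : |√q + 1| = √q + 1 := abs_of_nonneg (by positivity)
    rw [h1, abs_mul, h2]
    exact le_mul_of_one_le_right (abs_nonneg _) (by linarith [Real.sqrt_nonneg q])
  · rw [Real.sqrt_eq_zero_of_nonpos h, abs_of_nonpos, abs_of_nonpos] <;> linarith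

/-- Coverage in a single experiment. The estimation error is `β + s * Z` with `|β| ≤ B`; the law of
`Z` is close to normal on intervals, and `V` is an estimate of `s` with relative error at most `ρ`
outside an event of probability `ε`. The critical value at level `α` based on `V` is, outside that
event, not much below the nonrandom critical value at level `α + δ` based on `s`. -/
lemma le_coverage {Ω : Type*} [MeasurableSpace Ω] {μ : Measure Ω} [IsProbabilityMeasure μ]
    {α δ ρ T ε s B β : ℝ} (hα : α ∈ Set.Ioo (0 : ℝ) 1) (hδ : 0 < δ) (hαδ : α + δ < 1)
    (hρ1 : ρ < 1) (hρ0 : 0 ≤ ρ) (hT0 : 0 ≤ T)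
    (hT : (gaussianReal 0 1).real {z | T < |z|} ≤ δ) (hs : 0 < s) (hβ : |β| ≤ B) {Z V : Ω → ℝ}
    (hclt : ∀ b l : ℝ, coverProb b l ≤ μ.real {ω | |b + Z ω| ≤ l} + ε)
    (hbad : μ.real {ω | ρ < |V ω / s - 1|} ≤ ε) :
    1 - α - δ - 2 * (ρ * T) - 2 * ε ≤ μ.real {ω | |β + s * Z ω| ≤ cv α (B / V ω) * V ω} := by
  -- the nonrandom critical value that bounds the random one from below, up to `ρ * T`
  set c₀ := cv (α + δ) (B / s) with hc₀
  have h1 : 1 - (α + δ) ≤ coverProb (B / s) c₀ :=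
    le_coverProb_cv ⟨by linarith [hα.1], hαδ⟩ _
  have h2 : coverProb (B / s) c₀ ≤ coverProb (β / s) c₀ := by
    apply coverProb_le_of_abs_le
    rw [abs_div, abs_of_pos hs]
    gcongr
  have h3 := coverProb_add_le (β / s) (c₀ - ρ * T) (mul_nonneg hρ0 hT0)
  rw [sub_add_cancel] at h3
  have h4 := hclt (β / s) (c₀ - ρ * T)
  have hsub : {ω | |β / s + Z ω| ≤ c₀ - ρ * T} ⊆
      {ω | |β + s * Z ω| ≤ cv α (B / V ω) * V ω} ∪ {ω | ρ < |V ω / s - 1|} := by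
    intro ω hω
    by_cases hb : ρ < |V ω / s - 1|
    · exact Or.inr hb
    left
    have hb' := not_lt.1 hb
    have hr : 0 < V ω / s := by
      have := (abs_le.1 hb').1
      linarith
    have hV : 0 < V ω := by
      have := mul_pos hr hs
      rwa [div_mul_cancel₀ _ hs.ne'] at this
    have g1 := le_coverProb_cv hα (B / V ω)
    have g2 := coverProb_div_le (B / s) (cv α (B / V ω)) (T := T) hr hb'
    rw [div_div_div_cancel_right₀ hs.ne'] at g2
    have g3 : c₀ ≤ V ω / s * cv α (B / V ω) + ρ * T := cv_le hαδ (by linarith)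
    have hω' : |β / s + Z ω| ≤ c₀ - ρ * T := hω
    change |β + s * Z ω| ≤ cv α (B / V ω) * V ω
    calc |β + s * Z ω| = s * |β / s + Z ω| := by
          rw [← abs_of_pos hs, ← abs_mul, abs_of_pos hs]
          congr 1
          field_simp
      _ ≤ s * (V ω / s * cv α (B / V ω)) := by gcongr; linarith
      _ = _ := by field_simp
  have h5 := (measureReal_mono (μ := μ) hsub).trans (measureReal_union_le _ _)
  linarith

variable {E : Type*} [NormedAddCommGroup E]

lemma zero_mem_FLip {C : ℝ} (hC : 0 ≤ C) : (0 : E → Bool → ℝ) ∈ FLip C := fun d x x' => by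
  simpa using mul_nonneg hC (norm_nonneg _)

/-- Validity of the interval from three facts: the bias is at most `maxBias`, no weight dominates,
and the estimated variance of the estimator is consistent in `L¹`, uniformly over the regression
function. -/
theorem uniformlyValid_of_variance_consistent
    {x : (n : ℕ) → Fin n → E} {d : (n : ℕ) → Fin n → Bool} {C : ℕ → ℝ} (hC : ∀ n, 0 < C n)
    {Ω : ℕ → Type*} [∀ n, MeasurableSpace (Ω n)]
    {μ : (n : ℕ) → Measure (Ω n)} [∀ n, IsProbabilityMeasure (μ n)]
    {u : (n : ℕ) → Fin n → Ω n → ℝ} (hu : ∀ n i, Measurable (u n i))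
    (hind : ∀ n, iIndepFun (u n) (μ n)) (h1 : ∀ n i, Integrable (u n i) (μ n))
    (h0 : ∀ n i, ∫ ω, u n i ω ∂(μ n) = 0)
    (h2 : ∀ n i, Integrable (fun ω => u n i ω ^ 2) (μ n)) {K : ℝ} (hK : 0 < K)
    (hl : ∀ n i, 1 / K ≤ ∫ ω, u n i ω ^ 2 ∂(μ n)) (hup : ∀ n i, ∫ ω, u n i ω ^ 2 ∂(μ n) ≤ K)
    (hUI : UniformlySquareIntegrable μ u) {α : ℝ} (hα : α ∈ Set.Ioo (0 : ℝ) 1)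
    {k : (n : ℕ) → Fin n → ℝ} {v : (n : ℕ) → (Fin n → ℝ) → Fin n → ℝ}
    (hbias : ∀ᶠ n in atTop, ∀ f ∈ FLip (E := E) (C n),
      |∑ i, k n i * f (x n i) (d n i) - cate (x n) f| ≤ maxBias (C n) (x n) (d n) (k n))
    (hkpos : ∀ᶠ n in atTop, 0 < ∑ i, k n i ^ 2)
    (hmax : ∀ ε : ℝ, 0 < ε → ∀ᶠ n in atTop, ∀ i, k n i ^ 2 ≤ ε * ∑ j, k n j ^ 2)
    (hv : ∀ ε : ℝ, 0 < ε → ∀ᶠ n in atTop, ∀ f ∈ FLip (E := E) (C n),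
      Integrable (fun ω => ∑ i, k n i ^ 2 *
        (v n (outcome (x n) (d n) f fun i => u n i ω) i - ∫ ω', u n i ω' ^ 2 ∂(μ n))) (μ n) ∧
      ∫ ω, |∑ i, k n i ^ 2 * (v n (outcome (x n) (d n) f fun i => u n i ω) i -
        ∫ ω', u n i ω' ^ 2 ∂(μ n))| ∂(μ n) ≤ ε * ∑ j, k n j ^ 2) :
    UniformlyValid μ u α C x d k v := by
  set S2 : ℕ → ℝ := fun n => ∑ i, k n i ^ 2 * ∫ ω, u n i ω ^ 2 ∂(μ n) with hS2
  set s : ℕ → ℝ := fun n => √(S2 n) with hs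
  have hS2low : ∀ n, (∑ i, k n i ^ 2) ≤ K * S2 n := by
    intro n
    rw [hS2, Finset.mul_sum]
    refine Finset.sum_le_sum fun i _ => ?_
    have := hl n i
    rw [div_le_iff₀' hK] at this
    nlinarith [sq_nonneg (k n i)]
  have hS2pos : ∀ᶠ n in atTop, 0 < S2 n := by
    filter_upwards [hkpos] with n hn
    exact pos_of_mul_pos_right (hn.trans_le (hS2low n)) hK.le
  have hclt : ∀ ε : ℝ, 0 < ε → ∀ᶠ n in atTop, ∀ b l : ℝ,
      coverProb b l ≤ (μ n).real {ω | |b + ∑ i, k n i / s n * u n i ω| ≤ l} + ε := by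
    intro ε hε
    refine eventually_coverProb_le_sum hu hind h1 h0 h2 hK hl hup hUI ?_ ?_ hε
    · filter_upwards [hS2pos] with n hn
      have hsn : s n ^ 2 = S2 n := Real.sq_sqrt hn.le
      calc ∑ i, (k n i / s n) ^ 2 * ∫ ω, u n i ω ^ 2 ∂(μ n) = S2 n / s n ^ 2 := by
            rw [hS2, Finset.sum_div]
            exact Finset.sum_congr rfl fun i _ => by ring
        _ = 1 := by rw [hsn, div_self hn.ne']
    · intro e he
      filter_upwards [hS2pos, hmax (e ^ 2 / K) (by positivity)] with n hn hm i
      refine abs_le_of_sq_le_sq ?_ he.le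
      rw [div_pow, Real.sq_sqrt hn.le, div_le_iff₀ hn]
      calc k n i ^ 2 ≤ e ^ 2 / K * ∑ j, k n j ^ 2 := hm i
        _ ≤ e ^ 2 / K * (K * S2 n) := by gcongr; exact hS2low n
        _ = e ^ 2 * S2 n := by field_simp
  refine le_of_forall_pos_le_add fun ε hε => ?_
  rw [← sub_le_iff_le_add]
  have hbdd : ∀ n, BddBelow (Set.range fun f : (FLip (C n) : Set (E → Bool → ℝ)) =>
      (μ n).real {ω | cate (x n) f.1 ∈ feasibleCI α (C n) (x n) (d n) (k n)
        (v n (outcome (x n) (d n) f.1 fun i => u n i ω))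
        (outcome (x n) (d n) f.1 fun i => u n i ω)}) := fun n =>
    ⟨0, by rintro _ ⟨f, rfl⟩; exact measureReal_nonneg⟩
  refine le_liminf_of_le ?_ ?_
  · refine (isBoundedUnder_of ⟨1, fun n => ?_⟩ :
      IsBoundedUnder (· ≤ ·) atTop _).isCoboundedUnder_ge
    exact (ciInf_le (hbdd n) ⟨0, zero_mem_FLip (hC n).le⟩).trans measureReal_le_one
  obtain ⟨δ, hδ, hδε, hαδ⟩ : ∃ δ : ℝ, 0 < δ ∧ δ ≤ ε / 4 ∧ α + δ < 1 := by
    refine ⟨min (ε / 4) ((1 - α) / 2), lt_min (by linarith) (by linarith [hα.2]),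
      min_le_left _ _, ?_⟩
    have := min_le_right (ε / 4) ((1 - α) / 2)
    linarith [hα.2]
  obtain ⟨T, hT0, hT⟩ := exists_gaussian_tail_le hδ
  obtain ⟨ρ, hρ0, hρ1, hρT⟩ : ∃ ρ : ℝ, 0 < ρ ∧ ρ < 1 ∧ ρ * T ≤ ε / 8 := by
    refine ⟨min (1 / 2) (ε / (8 * T)), by positivity,
      (min_le_left _ _).trans_lt (by norm_num), ?_⟩
    calc min (1 / 2) (ε / (8 * T)) * T ≤ ε / (8 * T) * T := by gcongr; exact min_le_right _ _
      _ = ε / 8 := by field_simp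
  filter_upwards [hbias, hkpos, hS2pos, hclt (ε / 8) (by linarith),
    hv (ε / 8 * ρ / K) (by positivity)] with n hb hk hS hc hV
  have : Nonempty (FLip (C n) : Set (E → Bool → ℝ)) := ⟨⟨0, zero_mem_FLip (hC n).le⟩⟩
  refine le_ciInf fun f => ?_
  set y : Ω n → Fin n → ℝ := fun ω => outcome (x n) (d n) f.1 fun i => u n i ω with hy
  set V : Ω n → ℝ := fun ω => stdErr (k n) (v n (y ω)) with hVdef
  have hspos : 0 < s n := Real.sqrt_pos.2 hS
  obtain ⟨hDi, hD⟩ := hV f.1 f.2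
  have hbad : (μ n).real {ω | ρ < |V ω / s n - 1|} ≤ ε / 8 := by
    have hκ : 0 < ρ * (∑ j, k n j ^ 2) / K := by positivity
    have hsub : {ω | ρ < |V ω / s n - 1|} ⊆ {ω | ρ * (∑ j, k n j ^ 2) / K ≤
        |∑ i, k n i ^ 2 * (v n (y ω) i - ∫ ω', u n i ω' ^ 2 ∂(μ n))|} := by
      intro ω hω
      have hω' : ρ < |V ω / s n - 1| := hω
      have e1 : V ω / s n = √((∑ i, k n i ^ 2 * v n (y ω) i) / S2 n) := by
        rw [Real.sqrt_div' _ hS.le]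
        rfl
      have e2 : (∑ i, k n i ^ 2 * v n (y ω) i) / S2 n - 1 =
          (∑ i, k n i ^ 2 * (v n (y ω) i - ∫ ω', u n i ω' ^ 2 ∂(μ n))) / S2 n := by
        simp only [mul_sub, Finset.sum_sub_distrib]
        rw [sub_div, div_self hS.ne']
      have e3 := hω'.le.trans ((e1 ▸ abs_sqrt_sub_one_le _))
      rw [e2, abs_div, abs_of_pos hS, le_div_iff₀ hS] at e3
      refine le_trans ?_ e3
      rw [mul_div_assoc]
      refine mul_le_mul_of_nonneg_left ?_ hρ0.le
      rw [div_le_iff₀' hK]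
      exact hS2low n
    have hM := mul_meas_ge_le_integral_of_nonneg (Eventually.of_forall fun ω => abs_nonneg _)
      hDi.abs (ρ * (∑ j, k n j ^ 2) / K)
    refine (measureReal_mono hsub).trans ?_
    have h3 := hM.trans hD
    rw [show ε / 8 * ρ / K * ∑ j, k n j ^ 2 = ρ * (∑ j, k n j ^ 2) / K * (ε / 8) by ring] at h3
    exact le_of_mul_le_mul_left h3 hκ
  have hcov := le_coverage hα hδ hαδ hρ1 hρ0.le hT0.le hT hspos (hb f.1 f.2)
    (Z := fun ω => ∑ i, k n i / s n * u n i ω) hc hbad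
  refine le_trans (by linarith) (hcov.trans_eq ?_)
  congr 1
  ext ω
  have e : ∑ i, k n i * f.1 (x n i) (d n i) - cate (x n) f.1 +
      s n * ∑ i, k n i / s n * u n i ω = linEst (k n) (y ω) - cate (x n) f.1 := by
    have : s n * ∑ i, k n i / s n * u n i ω = ∑ i, k n i * u n i ω := by
      rw [Finset.mul_sum]
      exact Finset.sum_congr rfl fun i _ => by field_simp
    rw [this]
    simp only [linEst, hy, outcome, mul_add, Finset.sum_add_distrib]
    ring
  simp only [Set.mem_ofPred_eq, feasibleCI, Set.mem_Icc]
  rw [e, abs_le]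
  constructor <;> intro h <;> constructor <;> linarith [h.1, h.2]

/-! ### Radii, neighbors and the weights of the matching estimator -/

/-- If each of countably many properties holds eventually, then some sequence of indices tending to
infinity can be followed: a diagonal argument. -/
lemma exists_tendsto_eventually_diag {P : ℕ → ℕ → Prop} (h : ∀ m, ∀ᶠ n in atTop, P m n) :
    ∃ m : ℕ → ℕ, Tendsto m atTop atTop ∧ ∀ᶠ n in atTop, P (m n) n := by
  classical
  choose N hN using fun m => eventually_atTop.1 (h m)
  refine ⟨fun n => Nat.findGreatest (fun m => N m ≤ n) n, ?_, ?_⟩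
  · refine tendsto_atTop.2 fun b => ?_
    filter_upwards [eventually_ge_atTop (max b (N b))] with n hn
    exact Nat.le_findGreatest ((le_max_left _ _).trans hn) ((le_max_right _ _).trans hn)
  · filter_upwards [eventually_ge_atTop (N 0)] with n hn
    exact hN _ _ (Nat.findGreatest_spec (P := fun m => N m ≤ n) (Nat.zero_le n) hn)

lemma eventually_mul_log_le_sqrt (m : ℝ) (hm : 0 < m) :
    ∀ᶠ n : ℕ in atTop, m * Real.log n ≤ √n := by
  have h := (isLittleO_log_rpow_atTop (show (0 : ℝ) < 1 / 2 by norm_num)).bound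
    (show 0 < 1 / m by positivity)
  filter_upwards [tendsto_natCast_atTop_atTop.eventually h] with n hn
  rw [← Real.sqrt_eq_rpow, Real.norm_eq_abs, Real.norm_eq_abs,
    abs_of_nonneg (Real.sqrt_nonneg _), one_div, ← div_eq_inv_mul, le_div_iff₀' hm] at hn
  exact (mul_le_mul_of_nonneg_left (le_abs_self _) hm.le).trans hn

/-- Radii `a n` at which balls hold many more than `log n` units by the lower overlap bound, but
`o (√n)` units by the upper one: `a n` is `Ginv (m n * log n / n)` for slowly growing `m n`. -/
lemma exists_radius {Gup Glo Ginv : ℝ → ℝ}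
    (hGinv : ∀ᶠ t in 𝓝[>] (0 : ℝ), 0 < Ginv t ∧ Glo (Ginv t) = t)
    (hG : Tendsto (fun t : ℝ => Gup (Ginv t) ^ 2 / (t / Real.log t⁻¹)) (𝓝[>] 0) (𝓝 0)) :
    ∃ a : ℕ → ℝ, (∀ n, 0 < a n) ∧
      Tendsto (fun n : ℕ => (n : ℝ) * Glo (a n) / Real.log n) atTop atTop ∧
      Tendsto (fun n : ℕ => (n : ℝ) * Gup (a n) ^ 2) atTop (𝓝 0) := by
  classical
  set t : ℕ → ℕ → ℝ := fun m n => (m + 1 : ℝ) * Real.log n / n with ht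
  -- for fixed `m` the upper bound gives `n * Gup (Ginv (t m n)) ^ 2 → 0`; then let `m` grow slowly
  set P : ℕ → ℕ → Prop := fun m n => 0 < Ginv (t m n) ∧ Glo (Ginv (t m n)) = t m n ∧
    (n : ℝ) * Gup (Ginv (t m n)) ^ 2 ≤ 1 / (m + 1 : ℝ) with hP
  have hev : ∀ m, ∀ᶠ n in atTop, P m n := by
    intro m
    have hm : (0 : ℝ) < m + 1 := by positivity
    have hpos : ∀ᶠ n : ℕ in atTop, 0 < t m n := by
      filter_upwards [eventually_ge_atTop 2] with n hn
      have : 0 < Real.log n := Real.log_pos (by exact_mod_cast hn)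
      have : (0 : ℝ) < n := by positivity
      positivity
    have hle : ∀ᶠ n : ℕ in atTop, t m n ≤ (√n)⁻¹ := by
      filter_upwards [eventually_mul_log_le_sqrt _ hm, eventually_ge_atTop 1] with n hn h1
      have h2 : (0 : ℝ) < n := by positivity
      rw [ht, div_le_iff₀ h2, ← div_eq_inv_mul, Real.div_sqrt]
      exact hn
    have hsq : Tendsto (fun n : ℕ => (√(n : ℝ))⁻¹) atTop (𝓝 0) :=
      tendsto_inv_atTop_zero.comp (Real.tendsto_sqrt_atTop.comp tendsto_natCast_atTop_atTop)
    have htend : Tendsto (t m) atTop (𝓝[>] 0) := by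
      refine tendsto_nhdsWithin_iff.2 ⟨?_, hpos⟩
      exact squeeze_zero' (hpos.mono fun _ h => h.le) hle hsq
    have hGe := hG.eventually (gt_mem_nhds (show 0 < 1 / (2 * (m + 1 : ℝ) ^ 2) by positivity))
    filter_upwards [htend.eventually hGinv, htend.eventually hGe, hle, hpos,
      eventually_ge_atTop 2] with n h1 h2 h3 h4 h5
    refine ⟨h1.1, h1.2, ?_⟩
    have hn : (0 : ℝ) < n := by positivity
    have hlog : 0 < Real.log n := Real.log_pos (by exact_mod_cast h5)
    have hl : Real.log n / 2 ≤ Real.log (t m n)⁻¹ := by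
      rw [← Real.log_sqrt hn.le]
      refine Real.log_le_log (Real.sqrt_pos.2 hn) ?_
      rw [le_inv_comm₀ (Real.sqrt_pos.2 hn) h4]
      exact h3
    have hl0 : 0 < Real.log (t m n)⁻¹ := by linarith
    rw [div_lt_iff₀ (by positivity)] at h2
    calc (n : ℝ) * Gup (Ginv (t m n)) ^ 2
        ≤ n * (1 / (2 * (m + 1 : ℝ) ^ 2) * (t m n / Real.log (t m n)⁻¹)) := by gcongr
      _ ≤ n * (1 / (2 * (m + 1 : ℝ) ^ 2) * (t m n / (Real.log n / 2))) := by gcongr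
      _ = 1 / (m + 1 : ℝ) := by rw [ht]; field_simp
  obtain ⟨m, hm, hPm⟩ := exists_tendsto_eventually_diag hev
  have hm' : Tendsto (fun n => (m n : ℝ) + 1) atTop atTop :=
    tendsto_atTop_add_const_right _ _ (tendsto_natCast_atTop_atTop.comp hm)
  refine ⟨fun n => if P (m n) n then Ginv (t (m n) n) else 1, fun n => ?_, ?_, ?_⟩
  · dsimp only
    split_ifs with h
    · exact h.1
    · exact one_pos
  · refine hm'.congr' ?_
    filter_upwards [hPm, eventually_ge_atTop 2] with n hn h5
    have h6 : (0 : ℝ) < n := by positivity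
    have hlog : 0 < Real.log n := Real.log_pos (by exact_mod_cast h5)
    rw [if_pos hn, hn.2.1, ht]
    field_simp
  · refine squeeze_zero' (Eventually.of_forall fun n => by positivity) ?_
      (tendsto_inv_atTop_zero.comp hm')
    filter_upwards [hPm] with n hn
    rw [if_pos hn]
    simpa using hn.2.2

section
variable {E : Type*} [NormedAddCommGroup E] {n : ℕ} {x : Fin n → E} {d : Fin n → Bool}

lemma ballCount_mono (c : E) (t : Bool) {r r' : ℝ} (h : r ≤ r') :
    ballCount x d c t r ≤ ballCount x d c t r' := by
  refine Finset.card_le_card fun j hj => ?_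
  simp only [Finset.mem_filter, Finset.mem_univ, true_and] at hj ⊢
  exact ⟨hj.1.trans h, hj.2⟩

lemma one_le_ballCount_self (i : Fin n) {r : ℝ} (hr : 0 ≤ r) :
    1 ≤ ballCount x d (x i) (d i) r := by
  refine Finset.card_pos.2 ⟨i, ?_⟩
  simpa using hr

/-- If `k` candidates are within distance `r`, then so are any `k` nearest ones. -/
lemma IsNearestSet.dist_le {dist : Fin n → ℝ} {A S B : Finset (Fin n)} {k : ℕ}
    (h : IsNearestSet dist A k S) (hBA : B ⊆ A) (hB : k ≤ B.card) {r : ℝ}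
    (hr : ∀ l ∈ B, dist l ≤ r) {j : Fin n} (hj : j ∈ S) : dist j ≤ r := by
  by_contra hlt
  have hsub : B ⊂ S := by
    refine (Finset.ssubset_iff_of_subset fun l hl => ?_).2 ⟨j, hj, fun hjB => hlt (hr j hjB)⟩
    by_contra hlS
    exact hlt ((h.2.2 j hj l (hBA hl) hlS).trans (hr l hl))
  have := Finset.card_lt_card hsub
  rw [h.2.1] at this
  omega

lemma IsMatching.norm_sub_le {M : ℕ} {S : Fin n → Finset (Fin n)} (h : IsMatching x d M S) {r : ℝ}
    {i : Fin n} (hr : M ≤ ballCount x d (x i) (!d i) r) {j : Fin n} (hj : j ∈ S i) :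
    ‖x j - x i‖ ≤ r := by
  refine (h i).dist_le (B := Finset.univ.filter fun j => ‖x j - x i‖ ≤ r ∧ d j = !d i) ?_ hr ?_ hj
  · intro l hl
    simp only [Finset.mem_filter, Finset.mem_univ, true_and] at hl ⊢
    rw [hl.2]
    simp
  · intro l hl
    exact (Finset.mem_filter.1 hl).2.1

lemma IsMatching.ne {M : ℕ} {S : Fin n → Finset (Fin n)} (h : IsMatching x d M S)
    {i j : Fin n} (hj : j ∈ S i) : d j ≠ d i :=
  (Finset.mem_filter.1 ((h i).1 hj)).2

/-- Double counting: a sum over units, with the number of times that each of them is used as a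
match, is a sum over matches. -/
lemma sum_card_mul_eq (S : Fin n → Finset (Fin n)) (A : Finset (Fin n)) (g : Fin n → ℝ) :
    ∑ i ∈ A, ((Finset.univ.filter fun j => i ∈ S j).card : ℝ) * g i =
      ∑ j, ∑ i ∈ A ∩ S j, g i := by
  have h : ∀ i, ((Finset.univ.filter fun j => i ∈ S j).card : ℝ) * g i =
      ∑ j, if i ∈ S j then g i else 0 := fun i => by
    rw [← Finset.sum_filter, Finset.sum_const, nsmul_eq_mul]
  simp only [h]
  rw [Finset.sum_comm]
  refine Finset.sum_congr rfl fun j _ => ?_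
  rw [← Finset.sum_filter, Finset.filter_mem_eq_inter]

/-- In a finite-dimensional space a ball of radius `R * r` holds at most `N` times as many units as
the balls of radius `r` around units, with `N` depending on `R` only. -/
lemma exists_ballCount_mul_le (E : Type*) [NormedAddCommGroup E] [NormedSpace ℝ E]
    [FiniteDimensional ℝ E] (R : ℝ) :
    ∃ N : ℕ, ∀ {n : ℕ} {x : Fin n → E} {d : Fin n → Bool} {r g : ℝ}, 0 < r → 0 ≤ g →
      ∀ t, (∀ i, (ballCount x d (x i) t r : ℝ) ≤ g) →
        ∀ c, (ballCount x d c t (R * r) : ℝ) ≤ N * g := by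
  classical
  obtain ⟨T, -, hTf, hT⟩ := (isCompact_closedBall (0 : E) R).finite_cover_balls
    (show (0 : ℝ) < 1 / 2 by norm_num)
  lift T to Finset E using hTf
  refine ⟨T.card, fun {n x d r g} hr hg t h c => ?_⟩
  -- the pieces of a cover by balls of radius `r / 2`; a nonempty piece lies in the ball of radius `r`
  -- around any of its units
  set D : E → Finset (Fin n) := fun y =>
    Finset.univ.filter fun j => ‖x j - (c + r • y)‖ ≤ r / 2 ∧ d j = t with hD
  have hsub : (Finset.univ.filter fun j => ‖x j - c‖ ≤ R * r ∧ d j = t) ⊆ T.biUnion D := by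
    intro j hj
    simp only [Finset.mem_filter, Finset.mem_univ, true_and] at hj
    have hmem : r⁻¹ • (x j - c) ∈ Metric.closedBall (0 : E) R := by
      rw [mem_closedBall_zero_iff, norm_smul, Real.norm_eq_abs, abs_of_pos (inv_pos.2 hr),
        inv_mul_le_iff₀ hr, mul_comm r R]
      exact hj.1
    obtain ⟨y, hy, hjy⟩ := Set.mem_iUnion₂.1 (hT hmem)
    rw [Metric.mem_ball, dist_eq_norm] at hjy
    refine Finset.mem_biUnion.2 ⟨y, hy, Finset.mem_filter.2 ⟨Finset.mem_univ _, ?_, hj.2⟩⟩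
    have e : x j - (c + r • y) = r • (r⁻¹ • (x j - c) - y) := by
      rw [smul_sub, smul_smul, mul_inv_cancel₀ hr.ne', one_smul]
      abel
    rw [e, norm_smul, Real.norm_eq_abs, abs_of_pos hr]
    nlinarith
  have hDg : ∀ y, ((D y).card : ℝ) ≤ g := by
    intro y
    rcases (D y).eq_empty_or_nonempty with h0 | ⟨l, hl⟩
    · rw [h0]
      simpa using hg
    · refine le_trans (Nat.cast_le.2 (Finset.card_le_card fun j hj => ?_)) (h l)
      simp only [hD, Finset.mem_filter, Finset.mem_univ, true_and] at hj hl ⊢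
      refine ⟨?_, hj.2⟩
      calc ‖x j - x l‖ = ‖(x j - (c + r • y)) - (x l - (c + r • y))‖ := by congr 1; abel
        _ ≤ _ := norm_sub_le _ _
        _ ≤ r := by linarith [hj.1, hl.1]
  calc (ballCount x d c t (R * r) : ℝ) ≤ ((T.biUnion D).card : ℝ) :=
        Nat.cast_le.2 (Finset.card_le_card hsub)
    _ ≤ ∑ y ∈ T, ((D y).card : ℝ) := by exact_mod_cast Finset.card_biUnion_le
    _ ≤ ∑ _ ∈ T, g := Finset.sum_le_sum fun y _ => hDg y
    _ = T.card * g := by rw [Finset.sum_const, nsmul_eq_mul]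

end

section
variable {E : Type*} [NormedAddCommGroup E] {n : ℕ} {x : Fin n → E} {d : Fin n → Bool}
  {M : ℕ} {S : Fin n → Finset (Fin n)}

lemma matchWeight_sq (i : Fin n) : matchWeight d M S i ^ 2 =
    (1 + ((Finset.univ.filter fun j => i ∈ S j).card : ℝ) / M) ^ 2 / n ^ 2 := by
  rw [matchWeight, mul_pow, mul_pow]
  split_ifs <;> ring

lemma inv_le_sum_matchWeight_sq : 1 / (n : ℝ) ≤ ∑ i, matchWeight d M S i ^ 2 := by
  calc 1 / (n : ℝ) = ∑ _ : Fin n, 1 / (n : ℝ) ^ 2 := by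
        rw [Finset.sum_const, Finset.card_univ, Fintype.card_fin, nsmul_eq_mul]
        rcases eq_or_ne (n : ℝ) 0 with h | h
        · simp [h]
        · field_simp
    _ ≤ _ := by
        refine Finset.sum_le_sum fun i _ => ?_
        rw [matchWeight_sq]
        gcongr
        rw [one_le_sq_iff₀ (by positivity)]
        have : 0 ≤ ((Finset.univ.filter fun j => i ∈ S j).card : ℝ) / M := by positivity
        linarith

/-- The squared matching weights in a ball of radius `R * r` make up a small fraction of their
total, if no ball of radius `r` around a unit holds more than `g` units and matches are at most `r`
apart. A unit is used as a match at most `g` times, and the units of the ball are used as matches at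
most `M` times by each unit nearby. -/
lemma sum_window_matchWeight_sq_le (hM : 1 ≤ M) (hS : IsMatching x d M S) {r g R : ℝ} {N : ℕ}
    (hr : 0 ≤ r)
    (hnear : ∀ i, ∀ j ∈ S i, ‖x j - x i‖ ≤ r) (hg : ∀ i t, (ballCount x d (x i) t r : ℝ) ≤ g)
    (hN : ∀ i t, (ballCount x d (x i) t ((R + 1) * r) : ℝ) ≤ N * g) (i : Fin n) :
    ∑ m ∈ window x d (R * r) i, matchWeight d M S m ^ 2 ≤
      2 * N * (1 + M) * (g ^ 2 / n) * ∑ j, matchWeight d M S j ^ 2 := by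
  set L : Fin n → ℝ := fun m => ((Finset.univ.filter fun j => m ∈ S j).card : ℝ) with hL
  have hn : (0 : ℝ) < n := by exact_mod_cast i.pos
  have hM' : (1 : ℝ) ≤ M := by exact_mod_cast hM
  have hL0 : ∀ m, 0 ≤ L m := fun m => Nat.cast_nonneg _
  have hLg : ∀ m, L m ≤ g := by
    intro m
    refine le_trans (Nat.cast_le.2 (Finset.card_le_card fun j hj => ?_)) (hg m (!d m))
    simp only [Finset.mem_filter, Finset.mem_univ, true_and] at hj ⊢
    refine ⟨by rw [norm_sub_rev]; exact hnear j m hj, ?_⟩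
    exact Bool.eq_not.2 (hS.ne hj).symm
  have hg1 : 1 ≤ g := le_trans (by exact_mod_cast one_le_ballCount_self i hr) (hg i (d i))
  -- bound one factor `1 + L m` by `2 * g` and keep the other, which has a small sum over the ball
  have hsq : ∀ m, matchWeight d M S m ^ 2 ≤ 2 * g * (1 + L m) / n ^ 2 := by
    intro m
    rw [matchWeight_sq]
    gcongr
    have h1 : L m / M ≤ L m := div_le_self (hL0 m) hM'
    have h2 : 0 ≤ L m / M := div_nonneg (hL0 m) (by linarith)
    have h3 := hLg m
    have h4 := hL0 m
    calc (1 + L m / M) ^ 2 ≤ (1 + L m) * (1 + L m) := by rw [sq]; gcongr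
      _ ≤ 2 * g * (1 + L m) := by gcongr; linarith
  have hwin : ((window x d (R * r) i).card : ℝ) ≤ N * g := by
    refine le_trans (Nat.cast_le.2 ?_) (hN i (d i))
    exact ballCount_mono (x i) (d i) (by linarith)
  have hLsum : ∑ m ∈ window x d (R * r) i, L m ≤ M * (N * g) := by
    have h := sum_card_mul_eq S (window x d (R * r) i) fun _ => 1
    simp only [mul_one, Finset.sum_const, nsmul_eq_mul] at h
    rw [hL, h]
    calc ∑ j, ((window x d (R * r) i ∩ S j).card : ℝ)
        ≤ ∑ j, if ‖x j - x i‖ ≤ (R + 1) * r ∧ d j = !d i then (M : ℝ) else 0 := by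
          refine Finset.sum_le_sum fun j _ => ?_
          split_ifs with hj
          · rw [← (hS j).2.1]
            exact Nat.cast_le.2 (Finset.card_le_card Finset.inter_subset_right)
          · refine le_of_eq (Nat.cast_eq_zero.2 (Finset.card_eq_zero.2
              (Finset.eq_empty_iff_forall_notMem.2 ?_)))
            intro m hm
            obtain ⟨hm1, hm2⟩ := Finset.mem_inter.1 hm
            simp only [window, Finset.mem_filter, Finset.mem_univ, true_and] at hm1
            refine hj ⟨?_, ?_⟩
            · calc ‖x j - x i‖ = ‖(x m - x i) - (x m - x j)‖ := by congr 1; abel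
                _ ≤ _ := norm_sub_le _ _
                _ ≤ (R + 1) * r := by linarith [hnear j m hm2, hm1.1]
            · rw [← hm1.2]
              exact Bool.eq_not.2 (hS.ne hm2).symm
      _ = M * (ballCount x d (x i) (!d i) ((R + 1) * r) : ℝ) := by
          rw [← Finset.sum_filter, Finset.sum_const, nsmul_eq_mul, mul_comm]
          rfl
      _ ≤ M * (N * g) := by
          gcongr
          exact hN i _
  calc ∑ m ∈ window x d (R * r) i, matchWeight d M S m ^ 2
      ≤ ∑ m ∈ window x d (R * r) i, 2 * g * (1 + L m) / n ^ 2 :=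
        Finset.sum_le_sum fun m _ => hsq m
    _ = 2 * g / n ^ 2 * ((window x d (R * r) i).card + ∑ m ∈ window x d (R * r) i, L m) := by
        rw [Finset.card_eq_sum_ones, Nat.cast_sum, ← Finset.sum_add_distrib, Finset.mul_sum]
        refine Finset.sum_congr rfl fun m _ => ?_
        push_cast
        ring
    _ ≤ 2 * g / n ^ 2 * (N * g + M * (N * g)) := by gcongr
    _ = 2 * N * (1 + M) * (g ^ 2 / n) * (1 / n) := by field_simp
    _ ≤ _ := by
        gcongr
        exact inv_le_sum_matchWeight_sq

/-- The bias of a matching estimator is an average of differences of the regression function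
between units and their matches. In particular it is finite over a Lipschitz class. -/
lemma matching_bias_eq (hM : 1 ≤ M) (hS : IsMatching x d M S) (f : E → Bool → ℝ) :
    ∑ i, matchWeight d M S i * f (x i) (d i) - cate x f =
      ∑ j, ∑ i ∈ S j, (1 / (n : ℝ)) * (if d j then 1 else -1) * (1 / M) *
        (f (x j) (!d j) - f (x i) (!d j)) := by
  have hM' : (M : ℝ) ≠ 0 := by positivity
  set sg : Fin n → ℝ := fun i => if d i then 1 else -1 with hsg
  have e1 : ∑ i, matchWeight d M S i * f (x i) (d i) =
      ∑ j, (1 / (n : ℝ)) * sg j * f (x j) (d j) +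
      ∑ j, ∑ i ∈ S j, (1 / (n : ℝ)) * (1 / M) * (sg i * f (x i) (d i)) := by
    have h := sum_card_mul_eq S Finset.univ fun i =>
      (1 / (n : ℝ)) * (1 / M) * (sg i * f (x i) (d i))
    simp only [Finset.univ_inter] at h
    rw [← h, ← Finset.sum_add_distrib]
    refine Finset.sum_congr rfl fun i _ => ?_
    rw [matchWeight]
    ring
  have e2 : cate x f = ∑ j, (1 / (n : ℝ)) * sg j * (f (x j) (d j) - f (x j) (!d j)) := by
    rw [cate, Finset.mul_sum]
    refine Finset.sum_congr rfl fun j _ => ?_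
    simp only [hsg]
    cases d j
    · simp
      ring
    · simp
  rw [e1, e2, add_sub_right_comm, ← Finset.sum_sub_distrib, ← Finset.sum_add_distrib]
  refine Finset.sum_congr rfl fun j _ => ?_
  have e3 : ∀ i ∈ S j, (1 / (n : ℝ)) * (1 / M) * (sg i * f (x i) (d i)) =
      - ((1 / (n : ℝ)) * sg j * (1 / M) * f (x i) (!d j)) := by
    intro i hi
    have hd : d i = !d j := Bool.eq_not.2 (hS.ne hi)
    have hs : sg i = - sg j := by
      simp only [hsg, hd]
      cases d j <;> simp
    rw [hs, hd]
    ring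
  rw [Finset.sum_congr rfl e3]
  simp only [mul_sub, Finset.sum_sub_distrib, Finset.sum_neg_distrib, Finset.sum_const, (hS j).2.1,
    nsmul_eq_mul]
  field_simp
  ring

/-- The worst-case bias of a matching estimator is finite, and it bounds the bias in both directions
because the Lipschitz class is symmetric. -/
lemma abs_matching_bias_le_maxBias (hM : 1 ≤ M) (hS : IsMatching x d M S) {C : ℝ}
    {f : E → Bool → ℝ} (hf : f ∈ FLip C) :
    |∑ i, matchWeight d M S i * f (x i) (d i) - cate x f| ≤
      maxBias C x d (matchWeight d M S) := by
  have hbdd : BddAbove (Set.range fun f : (FLip C : Set (E → Bool → ℝ)) =>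
      ∑ i, matchWeight d M S i * f.1 (x i) (d i) - cate x f.1) := by
    refine ⟨∑ j, ∑ i ∈ S j, |(1 / (n : ℝ)) * (if d j then 1 else -1) * (1 / M)| *
      (C * ‖x j - x i‖), ?_⟩
    rintro _ ⟨f, rfl⟩
    simp only
    rw [matching_bias_eq hM hS]
    refine Finset.sum_le_sum fun j _ => Finset.sum_le_sum fun i _ => (le_abs_self _).trans ?_
    rw [abs_mul]
    exact mul_le_mul_of_nonneg_left (f.2 _ _ _) (abs_nonneg _)
  have hneg : -f ∈ FLip C := fun t z z' => by
    simp only [Pi.neg_apply]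
    rw [neg_sub_neg, abs_sub_comm]
    exact hf t z z'
  refine abs_le'.2 ⟨le_ciSup hbdd ⟨f, hf⟩, ?_⟩
  refine le_trans (le_of_eq ?_) (le_ciSup hbdd ⟨-f, hneg⟩)
  simp only [cate, Pi.neg_apply, mul_neg, Finset.sum_neg_distrib, Finset.sum_sub_distrib]
  ring

end

/-! ### Moments and consistency of variance estimates for a fixed sample -/

section
variable {Ω : Type*} [MeasurableSpace Ω] {μ : Measure Ω}

lemma integrable_sq_of_rpow {X : Ω → ℝ} (hX : Measurable X) {p : ℝ} (hp : 0 ≤ p)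
    (h : Integrable (fun ω => |X ω| ^ (2 + p)) μ) [IsFiniteMeasure μ] :
    Integrable (fun ω => X ω ^ 2) μ := by
  refine Integrable.mono' ((integrable_const (1 : ℝ)).add h) (by fun_prop)
    (Eventually.of_forall fun ω => ?_)
  rw [Real.norm_eq_abs, abs_of_nonneg (sq_nonneg _), ← sq_abs]
  have h0 := abs_nonneg (X ω)
  rcases le_total |X ω| 1 with h1 | h1
  · have : 0 ≤ |X ω| ^ (2 + p) := by positivity
    simp only [Pi.add_apply]
    nlinarith
  · have h2 : |X ω| ^ (2 : ℝ) ≤ |X ω| ^ (2 + p) := Real.rpow_le_rpow_of_exponent_le h1 (by linarith)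
    rw [Real.rpow_two] at h2
    simp only [Pi.add_apply]
    linarith

lemma integral_indicator_sq_le {X : Ω → ℝ} {p T B : ℝ} (hp : 0 ≤ p) (hT : 0 < T)
    (h : Integrable (fun ω => |X ω| ^ (2 + p)) μ) (hB : ∫ ω, |X ω| ^ (2 + p) ∂μ ≤ B) :
    ∫ ω, {ω | T < |X ω|}.indicator (fun ω => X ω ^ 2) ω ∂μ ≤ B / T ^ p := by
  have hTp : 0 < T ^ p := Real.rpow_pos_of_pos hT p
  refine (integral_mono_of_nonneg (g := fun ω => |X ω| ^ (2 + p) / T ^ p)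
    (Eventually.of_forall fun ω => Set.indicator_nonneg (fun _ _ => sq_nonneg _) _)
    (h.div_const _) (Eventually.of_forall fun ω => ?_)).trans ?_
  · simp only
    by_cases hω : T < |X ω|
    · rw [Set.indicator_of_mem (show ω ∈ {ω | T < |X ω|} from hω)]
      rw [le_div_iff₀ hTp, Real.rpow_add (hT.trans hω), Real.rpow_two, sq_abs]
      gcongr
    · rw [Set.indicator_of_notMem (show ω ∉ {ω | T < |X ω|} from hω)]
      positivity
  · rw [integral_div]
    gcongr
end

lemma uniformlySquareIntegrable_of_moment {Ω : ℕ → Type*} [∀ n, MeasurableSpace (Ω n)]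
    {μ : (n : ℕ) → Measure (Ω n)} {u : (n : ℕ) → Fin n → Ω n → ℝ} {K : ℝ} (hK : 0 < K)
    (hu_int : ∀ n i, Integrable (fun ω => |u n i ω| ^ (2 + 1 / K)) (μ n))
    (hu_mom : ∀ n i, ∫ ω, |u n i ω| ^ (2 + 1 / K) ∂(μ n) ≤ K) :
    UniformlySquareIntegrable μ u := by
  intro τ hτ
  have hT : 0 < (K / τ) ^ K := Real.rpow_pos_of_pos (by positivity) _
  refine ⟨(K / τ) ^ K, hT, fun n i => ?_⟩
  refine (integral_indicator_sq_le (by positivity) hT (hu_int n i) (hu_mom n i)).trans_eq ?_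
  rw [← Real.rpow_mul (by positivity), mul_one_div_cancel hK.ne', Real.rpow_one]
  field_simp

/-- Row `i` is the coefficient vector of the linear form `u i - (1 / J) * ∑ j ∈ N i, u j`, the
difference between an error and its average over the neighbors. -/
noncomputable def diffCoeff {ι : Type*} [DecidableEq ι] (J : ℕ) (N : ι → Finset ι) (i j : ι) : ℝ :=
  (if j = i then 1 else 0) - (if j ∈ N i then 1 / (J : ℝ) else 0)

section
variable {ι : Type*} [DecidableEq ι] {J : ℕ} {N : ι → Finset ι}

lemma sum_diffCoeff_mul [Fintype ι] (i : ι) (g : ι → ℝ) :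
    ∑ j, diffCoeff J N i j * g j = g i - 1 / (J : ℝ) * ∑ j ∈ N i, g j := by
  simp only [diffCoeff, sub_mul, ite_mul, one_mul, zero_mul, Finset.sum_sub_distrib,
    Finset.sum_ite_eq', Finset.mem_univ, if_true, Finset.sum_ite_mem, Finset.univ_inter,
    Finset.mul_sum]

lemma abs_diffCoeff {i : ι} (hi : i ∉ N i) (j : ι) :
    |diffCoeff J N i j| = (if j = i then 1 else 0) + (if j ∈ N i then 1 / (J : ℝ) else 0) := by
  unfold diffCoeff
  by_cases h : j = i
  · subst h
    simp [hi]
  · by_cases h' : j ∈ N i <;> simp [h, h']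

lemma diffCoeff_sq {i : ι} (hi : i ∉ N i) (j : ι) : diffCoeff J N i j ^ 2 =
    (if j = i then 1 else 0) + (if j ∈ N i then (1 / (J : ℝ)) ^ 2 else 0) := by
  unfold diffCoeff
  by_cases h : j = i
  · subst h
    simp [hi]
  · by_cases h' : j ∈ N i <;> simp [h, h']

end

section
variable {Ω : Type*} [MeasurableSpace Ω] {μ : Measure Ω} [IsProbabilityMeasure μ]
  {ι : Type*} [Fintype ι] {u : ι → Ω → ℝ}

/-- Consistency in `L¹` of weighted sums of squared residuals `(u i + β i + ∑ j, c i j * u j) ^ 2`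
when the fitted values `β i + ∑ j, c i j * u j` are accurate in mean square. -/
lemma integral_abs_sum_residual_sq_sub_le (hu : ∀ i, Measurable (u i)) (hind : iIndepFun u μ)
    (h0 : ∀ i, ∫ ω, u i ω ∂μ = 0) (h2 : ∀ i, Integrable (fun ω => u i ω ^ 2) μ)
    {K : ℝ} (hup : ∀ i, ∫ ω, u i ω ^ 2 ∂μ ≤ K) {T τ : ℝ} (hτ : 0 ≤ τ)
    (htail : ∀ i, ∫ ω, {ω | T < |u i ω|}.indicator (fun ω => u i ω ^ 2) ω ∂μ ≤ τ)
    {w : ι → ℝ} (hw : ∀ i, 0 ≤ w i) (hw1 : ∑ i, w i = 1) {θ : ℝ} (hθ0 : 0 ≤ θ)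
    (hθ : ∀ i, w i ≤ θ) {β : ι → ℝ} {c : ι → ι → ℝ} {b e l : ℝ} (hl : 0 < l)
    (hβ : ∀ i, |β i| ≤ b) (hc : ∀ i, ∑ j, c i j ^ 2 ≤ e) :
    ∫ ω, |∑ i, w i * ((u i ω + (β i + ∑ j, c i j * u j ω)) ^ 2 - ∫ ω', u i ω' ^ 2 ∂μ)| ∂μ ≤
      l * K + (1 / l + 1) * (2 * b ^ 2 + 2 * (e * K)) + (T ^ 2 * √(θ * 1) + 2 * 1 * τ) := by
  have hL := fun i => memLp_two_of_integrable_sq (hu i) (h2 i)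
  have hcL := fun i => memLp_sum_const_mul hu h2 (c i)
  have heL : ∀ i, MemLp (fun ω => β i + ∑ j, c i j * u j ω) 2 μ := fun i =>
    (memLp_const (β i)).add (hcL i)
  have hK0 : ∀ i : ι, 0 ≤ K := fun i => (integral_nonneg fun _ => sq_nonneg _).trans (hup i)
  have hee : ∀ i, ∫ ω, (β i + ∑ j, c i j * u j ω) ^ 2 ∂μ ≤ 2 * b ^ 2 + 2 * (e * K) := by
    intro i
    have hi : Integrable (fun ω => 2 * β i ^ 2 + 2 * (∑ j, c i j * u j ω) ^ 2) μ :=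
      (integrable_const _).add ((hcL i).integrable_sq.const_mul 2)
    calc ∫ ω, (β i + ∑ j, c i j * u j ω) ^ 2 ∂μ
        ≤ ∫ ω, (2 * β i ^ 2 + 2 * (∑ j, c i j * u j ω) ^ 2) ∂μ := by
          refine integral_mono (heL i).integrable_sq hi fun ω => ?_
          simp only
          nlinarith [sq_nonneg (β i - ∑ j, c i j * u j ω)]
      _ = 2 * β i ^ 2 + 2 * ∑ j, c i j ^ 2 * ∫ ω, u j ω ^ 2 ∂μ := by
          rw [integral_add (integrable_const _) ((hcL i).integrable_sq.const_mul 2), integral_const,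
            probReal_univ, one_smul, integral_const_mul, integral_sum_const_mul_sq hu hind h0 h2]
      _ ≤ 2 * b ^ 2 + 2 * ∑ j, c i j ^ 2 * K := by
          have := sq_le_sq' (abs_le.1 (hβ i)).1 (abs_le.1 (hβ i)).2
          have h3 : ∑ j, c i j ^ 2 * ∫ ω, u j ω ^ 2 ∂μ ≤ ∑ j, c i j ^ 2 * K :=
            Finset.sum_le_sum fun j _ => mul_le_mul_of_nonneg_left (hup j) (sq_nonneg _)
          linarith
      _ ≤ _ := by
          rw [← Finset.sum_mul]
          have := mul_le_mul_of_nonneg_right (hc i) (hK0 i)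
          linarith
  have b1 := integral_abs_sum_perturb_le hL heL hup hee hl hw hw1
  have b2 := integral_abs_sum_sq_sub_le hu hind h2 hτ htail hw hθ0 hθ hw1.le
  have i1 : Integrable (fun ω => |∑ i, w i *
      ((u i ω + (β i + ∑ j, c i j * u j ω)) ^ 2 - u i ω ^ 2)|) μ :=
    (integrable_finsetSum _ fun i _ =>
      ((((hL i).add (heL i)).integrable_sq).sub (h2 i)).const_mul _).abs
  have i2 : Integrable (fun ω => |∑ i, w i * (u i ω ^ 2 - ∫ ω', u i ω' ^ 2 ∂μ)|) μ :=
    (integrable_finsetSum _ fun i _ => ((h2 i).sub (integrable_const _)).const_mul _).abs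
  refine (integral_mono_of_nonneg (Eventually.of_forall fun _ => abs_nonneg _) (i1.add i2)
    (Eventually.of_forall fun ω => ?_)).trans ?_
  · simp only [Pi.add_apply]
    refine le_trans (le_of_eq ?_) (abs_add_le _ _)
    rw [← Finset.sum_add_distrib]
    congr 1
    exact Finset.sum_congr rfl fun i _ => by ring
  · rw [integral_add' i1 i2]
    exact add_le_add b1 b2

/-- Consistency in `L¹` of weighted sums of the nearest-neighbor variance estimates. The factor
`J / (J + 1)` makes each of them unbiased up to the variation of the mean (`b`) and of the variance
(`η`) over the neighbors. -/
lemma integral_abs_sum_neighbor_sub_le [DecidableEq ι] (hu : ∀ i, Measurable (u i))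
    (hind : iIndepFun u μ)
    (h0 : ∀ i, ∫ ω, u i ω ∂μ = 0) (h2 : ∀ i, Integrable (fun ω => u i ω ^ 2) μ)
    {K : ℝ} (hup : ∀ i, ∫ ω, u i ω ^ 2 ∂μ ≤ K) {T τ : ℝ} (hτ : 0 ≤ τ)
    (htail : ∀ i, ∫ ω, {ω | T < |u i ω|}.indicator (fun ω => u i ω ^ 2) ω ∂μ ≤ τ)
    {w : ι → ℝ} (hw : ∀ i, 0 ≤ w i) (hw1 : ∑ i, w i = 1) {J : ℕ} (hJ : 1 ≤ J) {N : ι → Finset ι}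
    (hNself : ∀ i, i ∉ N i) (hNcard : ∀ i, (N i).card = J) {θ : ℝ} (hθ0 : 0 ≤ θ)
    (hθ : ∀ i, ∑ m, w m * |diffCoeff J N m i| ≤ θ) {β : ι → ℝ} {b η l : ℝ} (hl : 0 < l)
    (hβ : ∀ i, |β i| ≤ b)
    (hη : ∀ i, ∀ j ∈ N i, |∫ ω, u j ω ^ 2 ∂μ - ∫ ω, u i ω ^ 2 ∂μ| ≤ η) :
    ∫ ω, |∑ i, w i * ((J : ℝ) / (J + 1) * (∑ j, diffCoeff J N i j * u j ω + β i) ^ 2 -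
        ∫ ω', u i ω' ^ 2 ∂μ)| ∂μ ≤
      l * (2 * K) + (1 / l + 1) * b ^ 2 +
        (T ^ 2 * √(θ * 2) + 2 * 2 * τ + √(2 * K ^ 2 * (θ * 4))) + η := by
  have hJ' : (1 : ℝ) ≤ J := by exact_mod_cast hJ
  have hJ0 : (0 : ℝ) < J := by linarith
  set r := diffCoeff J N with hr
  set v : ι → ℝ := fun i => ∫ ω, u i ω ^ 2 ∂μ with hv
  have hr1 : ∀ m i, |r m i| ≤ 1 := by
    intro m i
    rw [hr, abs_diffCoeff (hNself m)]
    have : 1 / (J : ℝ) ≤ 1 := by rw [div_le_one hJ0]; exact hJ'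
    by_cases h : i = m
    · subst h
      simp [hNself]
    · by_cases h' : i ∈ N m <;> simp [h, h']
      simpa using this
  have hr2 : ∀ m, ∑ i, |r m i| ≤ 2 := by
    intro m
    simp only [hr, abs_diffCoeff (hNself m), Finset.sum_add_distrib, Finset.sum_ite_eq',
      Finset.mem_univ, if_true, Finset.sum_ite_mem, Finset.univ_inter, Finset.sum_const, hNcard,
      nsmul_eq_mul]
    rw [mul_one_div_cancel hJ0.ne']
    norm_num
  have hrsq : ∀ m, ∑ i, r m i ^ 2 * v i = v m + (1 / (J : ℝ)) ^ 2 * ∑ i ∈ N m, v i := by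
    intro m
    simp only [hr, diffCoeff_sq (hNself m), add_mul, ite_mul, one_mul, zero_mul,
      Finset.sum_add_distrib, Finset.sum_ite_eq', Finset.mem_univ, if_true, Finset.sum_ite_mem,
      Finset.univ_inter, Finset.mul_sum]
  have hXL := fun i => memLp_sum_const_mul hu h2 (r i)
  have hX2 : ∀ i, ∫ ω, (∑ j, r i j * u j ω) ^ 2 ∂μ ≤ 2 * K := by
    intro i
    have hK0 : 0 ≤ K := (integral_nonneg fun _ => sq_nonneg _).trans (hup i)
    rw [integral_sum_const_mul_sq hu hind h0 h2]
    calc ∑ j, r i j ^ 2 * ∫ ω, u j ω ^ 2 ∂μ ≤ ∑ j, |r i j| * K := by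
          refine Finset.sum_le_sum fun j _ => mul_le_mul ?_ (hup j)
            (integral_nonneg fun _ => sq_nonneg _) (abs_nonneg _)
          rw [← sq_abs]
          nlinarith [hr1 i j, abs_nonneg (r i j)]
      _ ≤ 2 * K := by
          rw [← Finset.sum_mul]
          exact mul_le_mul_of_nonneg_right (hr2 i) hK0
  have hβL : ∀ i, MemLp (fun _ : Ω => β i) 2 μ := fun i => memLp_const _
  have hβ2 : ∀ i, ∫ _, β i ^ 2 ∂μ ≤ b ^ 2 := fun i => by
    rw [integral_const, probReal_univ, one_smul]
    exact sq_le_sq' (abs_le.1 (hβ i)).1 (abs_le.1 (hβ i)).2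
  have b1 := integral_abs_sum_perturb_le hXL hβL hX2 hβ2 hl hw hw1
  have b2 := integral_abs_sum_sq_linear_sub_le hu hind h0 h2 hup hτ htail hw hw1 hr1 hr2 hθ0 hθ
  have b3 : |∑ i, w i * ((J : ℝ) / (J + 1) * ∑ j, r i j ^ 2 * v j - v i)| ≤ η := by
    refine (Finset.abs_sum_le_sum_abs _ _).trans ?_
    calc ∑ i, |w i * ((J : ℝ) / (J + 1) * ∑ j, r i j ^ 2 * v j - v i)| ≤ ∑ i, w i * η := by
          refine Finset.sum_le_sum fun i _ => ?_
          rw [abs_mul, abs_of_nonneg (hw i)]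
          refine mul_le_mul_of_nonneg_left ?_ (hw i)
          have e : (J : ℝ) / (J + 1) * ∑ j, r i j ^ 2 * v j - v i =
              1 / ((J : ℝ) * (J + 1)) * ∑ j ∈ N i, (v j - v i) := by
            rw [hrsq, Finset.sum_sub_distrib, Finset.sum_const, hNcard, nsmul_eq_mul]
            field_simp
            ring
          obtain ⟨j, hj⟩ : (N i).Nonempty := Finset.card_pos.1 (by rw [hNcard]; omega)
          have hη0 : 0 ≤ η := (abs_nonneg _).trans (hη i j hj)
          rw [e, abs_mul, abs_of_pos (by positivity)]
          calc 1 / ((J : ℝ) * (J + 1)) * |∑ j ∈ N i, (v j - v i)|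
              ≤ 1 / ((J : ℝ) * (J + 1)) * ∑ j ∈ N i, η := by
                gcongr
                exact (Finset.abs_sum_le_sum_abs _ _).trans (Finset.sum_le_sum fun j hj => hη i j hj)
            _ = 1 / (J + 1) * η := by
                rw [Finset.sum_const, hNcard, nsmul_eq_mul]
                field_simp
            _ ≤ η := mul_le_of_le_one_left hη0 (by rw [div_le_one (by positivity)]; linarith)
      _ = η := by rw [← Finset.sum_mul, hw1, one_mul]
  have i1 : Integrable (fun ω => |∑ i, w i *
      ((∑ j, r i j * u j ω + β i) ^ 2 - (∑ j, r i j * u j ω) ^ 2)|) μ :=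
    (integrable_finsetSum _ fun i _ =>
      ((((hXL i).add (hβL i)).integrable_sq).sub (hXL i).integrable_sq).const_mul _).abs
  have i2 : Integrable (fun ω => |∑ i, w i *
      ((∑ j, r i j * u j ω) ^ 2 - ∑ j, r i j ^ 2 * v j)|) μ :=
    (integrable_finsetSum _ fun i _ =>
      ((hXL i).integrable_sq.sub (integrable_const _)).const_mul _).abs
  have hq0 : 0 ≤ (J : ℝ) / (J + 1) := by positivity
  have hq1 : (J : ℝ) / (J + 1) ≤ 1 := by
    rw [div_le_one (by positivity)]
    linarith
  refine (integral_mono_of_nonneg (Eventually.of_forall fun _ => abs_nonneg _)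
    ((i1.add i2).add (integrable_const η)) (Eventually.of_forall fun ω => ?_)).trans ?_
  · simp only [Pi.add_apply]
    have e : ∑ i, w i * ((J : ℝ) / (J + 1) * (∑ j, r i j * u j ω + β i) ^ 2 - v i) =
        (J : ℝ) / (J + 1) * (∑ i, w i *
          ((∑ j, r i j * u j ω + β i) ^ 2 - (∑ j, r i j * u j ω) ^ 2)) +
        (J : ℝ) / (J + 1) * (∑ i, w i *
          ((∑ j, r i j * u j ω) ^ 2 - ∑ j, r i j ^ 2 * v j)) +
        ∑ i, w i * ((J : ℝ) / (J + 1) * ∑ j, r i j ^ 2 * v j - v i) := by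
      rw [Finset.mul_sum, Finset.mul_sum, ← Finset.sum_add_distrib, ← Finset.sum_add_distrib]
      exact Finset.sum_congr rfl fun i _ => by ring
    rw [e]
    refine (abs_add_le _ _).trans (add_le_add ((abs_add_le _ _).trans (add_le_add ?_ ?_)) b3)
    · rw [abs_mul, abs_of_nonneg hq0]
      exact mul_le_of_le_one_left (abs_nonneg _) hq1
    · rw [abs_mul, abs_of_nonneg hq0]
      exact mul_le_of_le_one_left (abs_nonneg _) hq1
  · rw [integral_add' (i1.add i2) (integrable_const η), integral_add' i1 i2, integral_const,
      probReal_univ, one_smul]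
    exact add_le_add (add_le_add b1 b2) le_rfl

end

/-! ### Consistency of the variance estimates along the sequence of designs -/

/-- A norm on a finite-dimensional space, given as a seminorm, is equivalent to the norm. -/
lemma exists_seminorm_equiv {E : Type*} [NormedAddCommGroup E] [NormedSpace ℝ E]
    [FiniteDimensional ℝ E] (ν : Seminorm ℝ E) (hν : ∀ z, ν z = 0 → z = 0) :
    ∃ c C : ℝ, 0 < c ∧ 0 < C ∧ ∀ z, c * ‖z‖ ≤ ν z ∧ ν z ≤ C * ‖z‖ := by
  have hcont : Continuous ν := by
    have := ν.convexOn.locallyLipschitz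
    exact this.continuous
  obtain ⟨C, hC, hCν⟩ := Seminorm.bound_of_continuous_normedSpace ν hcont
  rcases subsingleton_or_nontrivial E with h | h
  · refine ⟨1, C, one_pos, hC, fun z => ⟨?_, hCν z⟩⟩
    rw [Subsingleton.elim z 0]
    simp
  obtain ⟨z₀, hz₀, hmin⟩ := (isCompact_sphere (0 : E) 1).exists_isMinOn
    (NormedSpace.sphere_nonempty.2 zero_le_one) hcont.continuousOn
  have hz₀1 : ‖z₀‖ = 1 := by simpa using hz₀
  have hpos : 0 < ν z₀ := by
    refine lt_of_le_of_ne (apply_nonneg ν z₀) fun h0 => ?_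
    rw [hν z₀ h0.symm] at hz₀1
    simp at hz₀1
  refine ⟨ν z₀, C, hpos, hC, fun z => ⟨?_, hCν z⟩⟩
  rcases eq_or_ne z 0 with rfl | hz
  · simp
  have hzn : 0 < ‖z‖ := norm_pos_iff.2 hz
  have h1 : ν z₀ ≤ ν (‖z‖⁻¹ • z) := hmin (by
    simp [norm_smul, inv_mul_cancel₀ hzn.ne'])
  rw [map_smul_eq_mul, Real.norm_eq_abs, abs_of_pos (inv_pos.2 hzn), ← div_eq_inv_mul,
    le_div_iff₀ hzn] at h1
  exact h1

section
variable {E : Type*} [NormedAddCommGroup E]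

/-- If a ball of radius `r` around `x i` holds the `J` neighbors needed, then the neighbors of `i`
are at most `C / c * r` away, even though they are nearest in a different norm. -/
lemma IsNeighborSystem.norm_sub_le [NormedSpace ℝ E] {n : ℕ} {x : Fin n → E} {d : Fin n → Bool}
    {ν : Seminorm ℝ E} {J : ℕ} {N : Fin n → Finset (Fin n)} (hN : IsNeighborSystem ν x d J N)
    {c C : ℝ} (hc : 0 < c) (hC : 0 < C) (hν : ∀ z, c * ‖z‖ ≤ ν z ∧ ν z ≤ C * ‖z‖) {r : ℝ}
    {i : Fin n} (hr : J + 1 ≤ ballCount x d (x i) (d i) r) {j : Fin n} (hj : j ∈ N i) :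
    ‖x j - x i‖ ≤ C / c * r := by
  have h : ν (x j - x i) ≤ C * r := by
    refine (hN i).dist_le
      (B := (Finset.univ.filter fun l => ‖x l - x i‖ ≤ r ∧ d l = d i).erase i) ?_ ?_ ?_ hj
    · intro l hl
      simp only [Finset.mem_erase, Finset.mem_filter, Finset.mem_univ, true_and] at hl ⊢
      exact ⟨hl.1, hl.2.2⟩
    · refine le_trans ?_ Finset.pred_card_le_card_erase
      exact Nat.le_sub_one_of_lt hr
    · intro l hl
      have := (Finset.mem_filter.1 (Finset.mem_erase.1 hl).2).2.1
      exact (hν _).2.trans (mul_le_mul_of_nonneg_left this hC.le)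
  rw [div_mul_eq_mul_div, le_div_iff₀' hc]
  exact (hν _).1.trans h

lemma abs_sub_sum_div_card_le {ι : Type*} {s : Finset ι} (hs : s.Nonempty) {g : ι → ℝ} {a b : ℝ}
    (h : ∀ j ∈ s, |g j - a| ≤ b) : |a - (∑ j ∈ s, g j) / (s.card : ℝ)| ≤ b := by
  have hc : (0 : ℝ) < s.card := by exact_mod_cast Finset.card_pos.2 hs
  have e : a - (∑ j ∈ s, g j) / (s.card : ℝ) = -((∑ j ∈ s, (g j - a)) / s.card) := by
    rw [Finset.sum_sub_distrib, Finset.sum_const, nsmul_eq_mul]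
    field_simp
    ring
  rw [e, abs_neg, abs_div, abs_of_pos hc, div_le_iff₀ hc]
  refine (Finset.abs_sum_le_sum_abs _ _).trans ((Finset.sum_le_sum h).trans_eq ?_)
  rw [Finset.sum_const, nsmul_eq_mul, mul_comm]

lemma tendsto_natCast_mul_div_log {c : ℝ} (hc : 0 < c) :
    Tendsto (fun n : ℕ => (n : ℝ) * c / Real.log n) atTop atTop := by
  have h : Tendsto (fun n : ℕ => c * √(n : ℝ)) atTop atTop :=
    (Real.tendsto_sqrt_atTop.comp tendsto_natCast_atTop_atTop).const_mul_atTop hc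
  refine tendsto_atTop_mono' _ ?_ h
  filter_upwards [eventually_mul_log_le_sqrt 1 one_pos, eventually_ge_atTop 2] with n hn h2
  have hlog : 0 < Real.log n := Real.log_pos (by exact_mod_cast h2)
  rw [one_mul] at hn
  rw [le_div_iff₀ hlog]
  calc c * √(n : ℝ) * Real.log n ≤ c * √(n : ℝ) * √(n : ℝ) := by gcongr
    _ = n * c := by rw [mul_assoc, Real.mul_self_sqrt (Nat.cast_nonneg n), mul_comm]

/-- Under the overlap condition balls with admissible radii hold arbitrarily many units. -/
lemma eventually_le_ballCount {x : (n : ℕ) → Fin n → E} {d : (n : ℕ) → Fin n → Bool} {X : Set E}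
    {Glo : ℝ → ℝ} {a : ℕ → ℝ}
    (ha : Tendsto (fun n : ℕ => (n : ℝ) * Glo (a n) / Real.log n) atTop atTop)
    (h : ∀ᶠ n : ℕ in atTop, ∀ z ∈ X, ∀ t : Bool,
      Glo (a n) ≤ (ballCount (x n) (d n) z t (a n) : ℝ) / n) (B : ℕ) :
    ∀ᶠ n in atTop, ∀ z ∈ X, ∀ t : Bool, B ≤ ballCount (x n) (d n) z t (a n) := by
  filter_upwards [h, ha.eventually_ge_atTop (B : ℝ), eventually_ge_atTop 3] with n h1 h2 h3 z hz t
  have hn : (0 : ℝ) < n := by positivity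
  have hlog : 1 ≤ Real.log n := by
    rw [Real.le_log_iff_exp_le hn]
    have h4 : (3 : ℝ) ≤ n := by exact_mod_cast h3
    linarith [Real.exp_one_lt_d9]
  rw [le_div_iff₀ (by linarith)] at h2
  have h5 := h1 z hz t
  rw [le_div_iff₀' hn] at h5
  have hB : (0 : ℝ) ≤ B := Nat.cast_nonneg B
  have : (B : ℝ) ≤ ballCount (x n) (d n) z t (a n) := by nlinarith
  exact_mod_cast this

/-- There are radii at which balls hold enough units for matching, while the squared matching
weights of the units in a ball, even one enlarged by a constant factor, are negligible. -/
lemma exists_radius_sum_window_le [NormedSpace ℝ E] [FiniteDimensional ℝ E]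
    {x : (n : ℕ) → Fin n → E} {d : (n : ℕ) → Fin n → Bool} {X : Set E} (hX : ∀ n i, x n i ∈ X)
    {Gup Glo Ginv : ℝ → ℝ} (hGup : ∀ a, 0 < a → 0 < Gup a)
    (hGinv : ∀ᶠ t in 𝓝[>] (0 : ℝ), 0 < Ginv t ∧ Glo (Ginv t) = t)
    (hG : Tendsto (fun t : ℝ => Gup (Ginv t) ^ 2 / (t / Real.log t⁻¹)) (𝓝[>] 0) (𝓝 0))
    (h_overlap : ∀ a : ℕ → ℝ, (∀ n, 0 < a n) →
      Tendsto (fun n : ℕ => (n : ℝ) * Glo (a n) / Real.log n) atTop atTop →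
      ∀ᶠ n : ℕ in atTop, ∀ z ∈ X, ∀ t : Bool,
        Glo (a n) ≤ (ballCount (x n) (d n) z t (a n) : ℝ) / n ∧
        (ballCount (x n) (d n) z t (a n) : ℝ) / n ≤ Gup (a n))
    {M : ℕ} (hM : 1 ≤ M) {S : (n : ℕ) → Fin n → Finset (Fin n)}
    (hS : ∀ᶠ n in atTop, IsMatching (x n) (d n) M (S n)) :
    ∃ a : ℕ → ℝ, (∀ n, 0 < a n) ∧
      (∀ B : ℕ, ∀ᶠ n in atTop, ∀ z ∈ X, ∀ t : Bool, B ≤ ballCount (x n) (d n) z t (a n)) ∧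
      ∀ R ε : ℝ, 0 < ε → ∀ᶠ n in atTop, ∀ i,
        ∑ m ∈ window (x n) (d n) (R * a n) i, matchWeight (d n) M (S n) m ^ 2 ≤
          ε * ∑ j, matchWeight (d n) M (S n) j ^ 2 := by
  obtain ⟨a, ha, hlo, hup⟩ := exists_radius hGinv hG
  have hcount := eventually_le_ballCount hlo
    ((h_overlap a ha hlo).mono fun n h z hz t => (h z hz t).1)
  refine ⟨a, ha, hcount, fun R ε hε => ?_⟩
  obtain ⟨N, hN⟩ := exists_ballCount_mul_le E (R + 1)
  have hsmall : ∀ᶠ n : ℕ in atTop, 2 * N * (1 + M) * ((n : ℝ) * Gup (a n) ^ 2) < ε := by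
    have := hup.const_mul (2 * (N : ℝ) * (1 + M))
    rw [mul_zero] at this
    exact this.eventually (gt_mem_nhds hε)
  filter_upwards [h_overlap a ha hlo, hcount M, hS, hsmall] with n h1 h2 h3 h4 i
  have hn : (0 : ℝ) < n := by exact_mod_cast i.pos
  have hg : ∀ i t, (ballCount (x n) (d n) (x n i) t (a n) : ℝ) ≤ n * Gup (a n) := by
    intro i t
    have := (h1 (x n i) (hX n i) t).2
    rwa [div_le_iff₀' hn] at this
  have hg0 : 0 ≤ n * Gup (a n) := mul_nonneg hn.le (hGup _ (ha n)).le
  refine (sum_window_matchWeight_sq_le hM h3 (ha n).le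
    (fun i j hj => h3.norm_sub_le (h2 _ (hX n i) _) hj) hg
    (fun i t => hN (ha n) hg0 t (fun i => hg i t) _) i).trans ?_
  refine mul_le_mul_of_nonneg_right ?_ (Finset.sum_nonneg fun _ _ => sq_nonneg _)
  refine le_trans (le_of_eq ?_) h4.le
  field_simp

end

section
variable {E : Type*} [NormedAddCommGroup E]
  {x : (n : ℕ) → Fin n → E} {d : (n : ℕ) → Fin n → Bool} {C : ℕ → ℝ}
  {Ω : ℕ → Type*} [∀ n, MeasurableSpace (Ω n)]
  {μ : (n : ℕ) → Measure (Ω n)} [∀ n, IsProbabilityMeasure (μ n)] {u : (n : ℕ) → Fin n → Ω n → ℝ}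

/-- Passing from weights `k i ^ 2` to the same weights normalized to total mass `1`. -/
lemma integrable_and_integral_abs_le_of_normalized {Ω ι : Type*} [MeasurableSpace Ω]
    {μ : Measure Ω} [Fintype ι] {k : ι → ℝ} (hk : 0 < ∑ i, k i ^ 2) {D : Ω → ι → ℝ} {ε : ℝ}
    (hD : ∀ i, Integrable (fun ω => D ω i) μ)
    (h : ∫ ω, |∑ i, k i ^ 2 / (∑ j, k j ^ 2) * D ω i| ∂μ ≤ ε) :
    Integrable (fun ω => ∑ i, k i ^ 2 * D ω i) μ ∧
      ∫ ω, |∑ i, k i ^ 2 * D ω i| ∂μ ≤ ε * ∑ j, k j ^ 2 := by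
  refine ⟨integrable_finsetSum _ fun i _ => (hD i).const_mul _, ?_⟩
  have e : ∀ ω, |∑ i, k i ^ 2 * D ω i| =
      (∑ j, k j ^ 2) * |∑ i, k i ^ 2 / (∑ j, k j ^ 2) * D ω i| := fun ω => by
    rw [← abs_of_pos hk, ← abs_mul, abs_of_pos hk, Finset.mul_sum]
    congr 1
    exact Finset.sum_congr rfl fun i _ => by field_simp
  simp only [e]
  rw [integral_const_mul, mul_comm]
  exact mul_le_mul_of_nonneg_right h hk.le

/-- The squared Nadaraya-Watson residuals estimate the variance of a linear estimator consistently in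
`L¹`, uniformly over the Lipschitz class, as long as no weight dominates. -/
theorem nwVar_consistent (hu : ∀ n i, Measurable (u n i)) (hind : ∀ n, iIndepFun (u n) (μ n))
    (h0 : ∀ n i, ∫ ω, u n i ω ∂(μ n) = 0) (h2 : ∀ n i, Integrable (fun ω => u n i ω ^ 2) (μ n))
    {K : ℝ} (hK : 0 < K) (hup : ∀ n i, ∫ ω, u n i ω ^ 2 ∂(μ n) ≤ K)
    (hUI : UniformlySquareIntegrable μ u) (hC : ∀ n, 0 < C n) {k : (n : ℕ) → Fin n → ℝ}
    (hkpos : ∀ᶠ n in atTop, 0 < ∑ i, k n i ^ 2)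
    (hmax : ∀ ε : ℝ, 0 < ε → ∀ᶠ n in atTop, ∀ i, k n i ^ 2 ≤ ε * ∑ j, k n j ^ 2)
    {h : ℕ → ℝ} (hh : Tendsto (fun n => h n * C n) atTop (𝓝 0)) (hcount : MinCountTendsto x d h)
    {ε : ℝ} (hε : 0 < ε) :
    ∀ᶠ n in atTop, ∀ f ∈ FLip (E := E) (C n),
      Integrable (fun ω => ∑ i, k n i ^ 2 *
        (nwVar (x n) (d n) (h n) (outcome (x n) (d n) f fun i => u n i ω) i -
          ∫ ω', u n i ω' ^ 2 ∂(μ n))) (μ n) ∧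
      ∫ ω, |∑ i, k n i ^ 2 *
        (nwVar (x n) (d n) (h n) (outcome (x n) (d n) f fun i => u n i ω) i -
          ∫ ω', u n i ω' ^ 2 ∂(μ n))| ∂(μ n) ≤ ε * ∑ j, k n j ^ 2 := by
  obtain ⟨T, -, hT⟩ := hUI (ε / 8) (by positivity)
  set l := ε / (4 * K) with hl
  have hl0 : 0 < l := by positivity
  -- a common bound for the smoothing bias, the inverse window sizes and the largest weight
  obtain ⟨q, hq, hq0⟩ : ∃ q : ℝ,
      (1 / l + 1) * (2 * q ^ 2 + 2 * (q * K)) + T ^ 2 * √(q * 1) < ε / 4 ∧ 0 < q := by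
    have hc : Continuous fun q : ℝ =>
        (1 / l + 1) * (2 * q ^ 2 + 2 * (q * K)) + T ^ 2 * √(q * 1) := by fun_prop
    have := (hc.tendsto 0).mono_left (nhdsWithin_le_nhds (s := Set.Ioi 0))
    simp only [zero_mul, Real.sqrt_zero, mul_zero, add_zero, ne_eq, OfNat.ofNat_ne_zero,
      not_false_eq_true, zero_pow] at this
    exact ((this.eventually (gt_mem_nhds (show 0 < ε / 4 by linarith))).and
      self_mem_nhdsWithin).exists
  obtain ⟨m, hm⟩ := exists_nat_ge (1 / q)
  filter_upwards [hkpos, hmax q hq0, hh.eventually (gt_mem_nhds hq0), hcount (max m 1)]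
    with n hk hmx hb hcnt f hf
  set W := window (x n) (d n) (h n) with hW
  have hWcard : ∀ i, max m 1 ≤ (W i).card := hcnt
  have hWne : ∀ i, (W i).Nonempty := fun i =>
    Finset.card_pos.1 (lt_of_lt_of_le (by simp) (hWcard i))
  have hWpos : ∀ i, (0 : ℝ) < (W i).card := fun i => by
    exact_mod_cast Finset.card_pos.2 (hWne i)
  set g : Fin n → ℝ := fun j => f (x n j) (d n j) with hg
  set β : Fin n → ℝ := fun i => g i - (∑ j ∈ W i, g j) / ((W i).card : ℝ) with hβ
  set c : Fin n → Fin n → ℝ := fun i j => if j ∈ W i then -(1 / ((W i).card : ℝ)) else 0 with hc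
  have hv : ∀ ω i, nwVar (x n) (d n) (h n) (outcome (x n) (d n) f fun i => u n i ω) i =
      (u n i ω + (β i + ∑ j, c i j * u n j ω)) ^ 2 := by
    intro ω i
    simp only [nwVar, outcome, hβ, hc, hg, ← hW, ite_mul, zero_mul, Finset.sum_ite_mem,
      Finset.univ_inter, Finset.sum_add_distrib, ← Finset.mul_sum]
    congr 1
    ring
  have hβb : ∀ i, |β i| ≤ q := by
    intro i
    refine abs_sub_sum_div_card_le (hWne i) fun j hj => ?_
    obtain ⟨hj1, hj2⟩ := (Finset.mem_filter.1 hj).2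
    simp only [hg, hj2]
    refine (hf _ _ _).trans (le_trans ?_ hb.le)
    rw [mul_comm]
    exact mul_le_mul_of_nonneg_right hj1 (hC n).le
  have hcb : ∀ i, ∑ j, c i j ^ 2 ≤ q := by
    intro i
    have e : ∑ j, c i j ^ 2 = 1 / ((W i).card : ℝ) := by
      simp only [hc, ite_pow, neg_sq, ne_eq, OfNat.ofNat_ne_zero, not_false_eq_true, zero_pow,
        Finset.sum_ite_mem, Finset.univ_inter, Finset.sum_const, nsmul_eq_mul]
      have := hWpos i
      field_simp
    rw [e, one_div_le (hWpos i) hq0]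
    exact hm.trans (Nat.cast_le.2 ((le_max_left _ _).trans (hWcard i)))
  have hL := fun i => memLp_two_of_integrable_sq (hu n i) (h2 n i)
  simp only [hv]
  refine integrable_and_integral_abs_le_of_normalized hk (fun i => ?_) ?_
  · exact (((hL i).add ((memLp_const (β i)).add
      (memLp_sum_const_mul (hu n) (h2 n) (c i)))).integrable_sq).sub (integrable_const _)
  · refine (integral_abs_sum_residual_sq_sub_le (hu n) (hind n) (h0 n) (h2 n) (hup n)
      (τ := ε / 8) (by positivity) (hT n) (fun i => by positivity)
      (by rw [← Finset.sum_div, div_self hk.ne']) hq0.le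
      (fun i => by rw [div_le_iff₀ hk]; exact hmx i) hl0 hβb hcb).trans ?_
    have : l * K = ε / 4 := by rw [hl]; field_simp
    linarith

/-- The nearest-neighbor variance estimates estimate the variance of a linear estimator consistently
in `L¹`, uniformly over the Lipschitz class. Since neighbors are nearest in a norm of their own and
ties are arbitrary, a unit may be a neighbor of many others; all of them lie in a ball of radius
`R * a n` around it, where the weights are negligible. -/
theorem nnVar_consistent [NormedSpace ℝ E] [FiniteDimensional ℝ E]
    (hu : ∀ n i, Measurable (u n i)) (hind : ∀ n, iIndepFun (u n) (μ n))
    (h0 : ∀ n i, ∫ ω, u n i ω ∂(μ n) = 0) (h2 : ∀ n i, Integrable (fun ω => u n i ω ^ 2) (μ n))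
    {σ2 : E → Bool → ℝ} (hu_var : ∀ n i, ∫ ω, (u n i ω) ^ 2 ∂(μ n) = σ2 (x n i) (d n i))
    (hσ : ∀ t : Bool, UniformContinuous fun z => σ2 z t)
    {K : ℝ} (hK : 0 < K) (hup : ∀ n i, ∫ ω, u n i ω ^ 2 ∂(μ n) ≤ K)
    (hUI : UniformlySquareIntegrable μ u) (hC : ∀ n, 0 < C n) {k : (n : ℕ) → Fin n → ℝ}
    (hkpos : ∀ᶠ n in atTop, 0 < ∑ i, k n i ^ 2)
    {a : ℕ → ℝ} (ha : ∀ n, 0 < a n) (hacount : MinCountTendsto x d a)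
    (haweight : ∀ R ε : ℝ, 0 < ε → ∀ᶠ n in atTop, ∀ i,
      ∑ m ∈ window (x n) (d n) (R * a n) i, k n m ^ 2 ≤ ε * ∑ j, k n j ^ 2)
    (hdense : ∀ η : ℝ, 0 < η → MinCountTendsto x d fun n => η / C n)
    (hdense' : ∀ r : ℝ, 0 < r → MinCountTendsto x d fun _ => r)
    {ν : Seminorm ℝ E} (hν : ∀ z, ν z = 0 → z = 0) {J : ℕ} (hJ : 1 ≤ J)
    {N : (n : ℕ) → Fin n → Finset (Fin n)}
    (hN : ∀ᶠ n in atTop, IsNeighborSystem ν (x n) (d n) J (N n)) {ε : ℝ} (hε : 0 < ε) :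
    ∀ᶠ n in atTop, ∀ f ∈ FLip (E := E) (C n),
      Integrable (fun ω => ∑ i, k n i ^ 2 *
        (nnVar J (N n) (outcome (x n) (d n) f fun i => u n i ω) i -
          ∫ ω', u n i ω' ^ 2 ∂(μ n))) (μ n) ∧
      ∫ ω, |∑ i, k n i ^ 2 *
        (nnVar J (N n) (outcome (x n) (d n) f fun i => u n i ω) i -
          ∫ ω', u n i ω' ^ 2 ∂(μ n))| ∂(μ n) ≤ ε * ∑ j, k n j ^ 2 := by
  classical
  obtain ⟨c₁, c₂, hc₁, hc₂, hcν⟩ := exists_seminorm_equiv ν hν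
  set R := c₂ / c₁ with hR
  have hR0 : 0 < R := by positivity
  obtain ⟨T, -, hT⟩ := hUI (ε / 32) (by positivity)
  set l := ε / (8 * K) with hl
  have hl0 : 0 < l := by positivity
  -- a common bound for the bias of the local averages and the influence of a single error
  obtain ⟨q, hq, hq0⟩ : ∃ q : ℝ, (1 / l + 1) * q ^ 2 +
      (T ^ 2 * √(q * 2) + √(2 * K ^ 2 * (q * 4))) < ε / 4 ∧ 0 < q := by
    have hc : Continuous fun q : ℝ => (1 / l + 1) * q ^ 2 +
        (T ^ 2 * √(q * 2) + √(2 * K ^ 2 * (q * 4))) := by fun_prop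
    have := (hc.tendsto 0).mono_left (nhdsWithin_le_nhds (s := Set.Ioi 0))
    simp only [zero_mul, Real.sqrt_zero, mul_zero, add_zero, ne_eq, OfNat.ofNat_ne_zero,
      not_false_eq_true, zero_pow] at this
    exact ((this.eventually (gt_mem_nhds (show 0 < ε / 4 by linarith))).and
      self_mem_nhdsWithin).exists
  -- a constant radius on which the variance hardly varies; it need not be comparable to `1 / C n`
  obtain ⟨r, hr0, hr⟩ : ∃ r : ℝ, 0 < r ∧ ∀ t, ∀ z z' : E, ‖z - z'‖ ≤ R * r →
      |σ2 z t - σ2 z' t| ≤ ε / 8 := by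
    have h1 : ∀ t, ∃ δ : ℝ, 0 < δ ∧ ∀ z z' : E, ‖z - z'‖ < δ → |σ2 z t - σ2 z' t| ≤ ε / 8 := by
      intro t
      obtain ⟨δ, hδ, h⟩ := Metric.uniformContinuous_iff.1 (hσ t) (ε / 8) (by positivity)
      refine ⟨δ, hδ, fun z z' hz => ?_⟩
      rw [← dist_eq_norm] at hz
      exact (h hz).le
    choose δ hδ hδσ using h1
    have hmin : 0 < min (δ true) (δ false) := lt_min (hδ _) (hδ _)
    refine ⟨min (δ true) (δ false) / (2 * R), by positivity, fun t z z' hz => hδσ t z z' ?_⟩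
    have e : R * (min (δ true) (δ false) / (2 * R)) = min (δ true) (δ false) / 2 := by field_simp
    have h3 : min (δ true) (δ false) ≤ δ t := by cases t <;> simp
    linarith
  filter_upwards [hkpos, haweight R q hq0, hN, hacount (J + 1), hdense' r hr0 (J + 1),
    hdense (q / R) (by positivity) (J + 1)] with n hk hw hNn hn1 hn2 hn3 f hf
  have hJ0 : (0 : ℝ) < J := by exact_mod_cast hJ
  have hNself : ∀ i, i ∉ N n i := fun i hi => (Finset.mem_filter.1 ((hNn i).1 hi)).2.1 rfl
  have hNcard : ∀ i, (N n i).card = J := fun i => (hNn i).2.1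
  have hNd : ∀ i, ∀ j ∈ N n i, d n j = d n i := fun i j hj =>
    (Finset.mem_filter.1 ((hNn i).1 hj)).2.2
  set g : Fin n → ℝ := fun j => f (x n j) (d n j) with hg
  set β : Fin n → ℝ := fun i => g i - 1 / (J : ℝ) * ∑ j ∈ N n i, g j with hβ
  have hv : ∀ ω i, nnVar J (N n) (outcome (x n) (d n) f fun i => u n i ω) i =
      (J : ℝ) / (J + 1) * (∑ j, diffCoeff J (N n) i j * u n j ω + β i) ^ 2 := by
    intro ω i
    rw [sum_diffCoeff_mul]
    simp only [nnVar, outcome, hβ, hg, Finset.sum_add_distrib]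
    ring
  have hβb : ∀ i, |β i| ≤ q := by
    intro i
    have hne : (N n i).Nonempty := Finset.card_pos.1 (by rw [hNcard]; omega)
    have h := abs_sub_sum_div_card_le (g := g) (a := g i) (b := q) hne fun j hj => ?_
    · rwa [hNcard, div_eq_inv_mul, ← one_div] at h
    · simp only [hg, hNd i j hj]
      refine (hf _ _ _).trans ?_
      calc C n * ‖x n j - x n i‖ ≤ C n * (R * (q / R / C n)) :=
            mul_le_mul_of_nonneg_left (hNn.norm_sub_le hc₁ hc₂ hcν (hn3 i) hj) (hC n).le
        _ = q := by
            have := hC n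
            field_simp
  have hη : ∀ i, ∀ j ∈ N n i,
      |∫ ω, u n j ω ^ 2 ∂(μ n) - ∫ ω, u n i ω ^ 2 ∂(μ n)| ≤ ε / 8 := by
    intro i j hj
    rw [hu_var, hu_var, hNd i j hj]
    exact hr _ _ _ (hNn.norm_sub_le hc₁ hc₂ hcν (hn2 i) hj)
  have hθ : ∀ i, ∑ m, k n m ^ 2 / (∑ j, k n j ^ 2) * |diffCoeff J (N n) m i| ≤ q := by
    intro i
    calc ∑ m, k n m ^ 2 / (∑ j, k n j ^ 2) * |diffCoeff J (N n) m i|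
        ≤ ∑ m, if m ∈ window (x n) (d n) (R * a n) i then k n m ^ 2 / (∑ j, k n j ^ 2) else 0 := by
          refine Finset.sum_le_sum fun m _ => ?_
          split_ifs with hmw
          · refine mul_le_of_le_one_right (by positivity) ?_
            rw [abs_diffCoeff (hNself m)]
            have h1 : 1 / (J : ℝ) ≤ 1 := by rw [div_le_one hJ0]; exact_mod_cast hJ
            by_cases h : i = m
            · subst h
              simp [hNself]
            · by_cases h' : i ∈ N n m <;> simp [h, h']
              simpa using h1
          · have h1 : i ≠ m := by
              rintro rfl
              exact hmw (by simpa [window] using mul_nonneg hR0.le (ha n).le)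
            have h2 : i ∉ N n m := fun hi => hmw (by
              simp only [window, Finset.mem_filter, Finset.mem_univ, true_and]
              exact ⟨by rw [norm_sub_rev]; exact hNn.norm_sub_le hc₁ hc₂ hcν (hn1 m) hi,
                (hNd m i hi).symm⟩)
            simp [diffCoeff, h1, h2]
      _ = (∑ m ∈ window (x n) (d n) (R * a n) i, k n m ^ 2) / (∑ j, k n j ^ 2) := by
          rw [Finset.sum_ite_mem, Finset.univ_inter, Finset.sum_div]
      _ ≤ q := by
          rw [div_le_iff₀ hk]
          exact hw i
  simp only [hv]
  refine integrable_and_integral_abs_le_of_normalized hk (fun i => ?_) ?_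
  · exact (((memLp_sum_const_mul (hu n) (h2 n) (diffCoeff J (N n) i)).add
      (memLp_const (β i))).integrable_sq.const_mul _).sub (integrable_const _)
  · refine (integral_abs_sum_neighbor_sub_le (hu n) (hind n) (h0 n) (h2 n) (hup n)
      (τ := ε / 32) (by positivity) (hT n) (fun i => by positivity)
      (by rw [← Finset.sum_div, div_self hk.ne']) hJ hNself hNcard hq0.le hθ hl0 hβb hη).trans ?_
    have : l * (2 * K) = ε / 4 := by rw [hl]; field_simp; norm_num
    linarith

/-- All sufficiently slow bandwidths fill the windows: a diagonal sequence of the constants `η` for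
which the design is dense at scale `η / C n`. -/
lemma exists_slow_bandwidth (hC : ∀ n, 0 < C n)
    (h : ∀ η : ℝ, 0 < η → MinCountTendsto x d fun n => η / C n) :
    ∃ ρ : ℕ → ℝ, (∀ n, 0 < ρ n) ∧ Tendsto ρ atTop (𝓝 0) ∧
      ∀ h : ℕ → ℝ, (∀ᶠ n in atTop, ρ n ≤ h n * C n) → MinCountTendsto x d h := by
  obtain ⟨m, hm, hev⟩ := exists_tendsto_eventually_diag
    (P := fun m n => ∀ i : Fin n,
      m ≤ ballCount (x n) (d n) (x n i) (d n i) (1 / ((m : ℝ) + 1) / C n))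
    fun m => h _ (by positivity) m
  refine ⟨fun n => 1 / ((m n : ℝ) + 1), fun n => by positivity,
    tendsto_one_div_add_atTop_nhds_zero_nat.comp hm, fun b hb B => ?_⟩
  filter_upwards [hb, hev, hm.eventually_ge_atTop B] with n h1 h2 h3 i
  refine h3.trans ((h2 i).trans (ballCount_mono _ _ ?_))
  rwa [div_le_iff₀ (hC n)]

end

end BiasAwareCI

/-! ### Validity of the confidence intervals -/

theorem mainTheorem6
    -- the covariate space, with its norm, and the design
    {E : Type*} [NormedAddCommGroup E] [NormedSpace ℝ E] [FiniteDimensional ℝ E]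
    (x : (n : ℕ) → Fin n → E) (d : (n : ℕ) → Fin n → Bool)
    (C : ℕ → ℝ) (hC : ∀ n, 0 < C n)
    -- the errors
    {Ω : ℕ → Type*} [∀ n, MeasurableSpace (Ω n)]
    (μ : (n : ℕ) → Measure (Ω n)) [∀ n, IsProbabilityMeasure (μ n)]
    (u : (n : ℕ) → Fin n → Ω n → ℝ)
    (hu_meas : ∀ n i, Measurable (u n i))
    (hu_indep : ∀ n, iIndepFun (u n) (μ n))
    (hu_mean : ∀ n i, ∫ ω, u n i ω ∂(μ n) = 0)
    (σ2 : E → Bool → ℝ)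
    (hu_var : ∀ n i, ∫ ω, (u n i ω) ^ 2 ∂(μ n) = σ2 (x n i) (d n i))
    (hσ : ∀ t : Bool, UniformContinuous fun z => σ2 z t)
    (K : ℝ) (hK : 0 < K)
    (hu_var_lower : ∀ n i, 1 / K ≤ ∫ ω, (u n i ω) ^ 2 ∂(μ n))
    (hu_var_upper : ∀ n i, ∫ ω, (u n i ω) ^ 2 ∂(μ n) ≤ K)
    (hu_int : ∀ n i, Integrable (fun ω => |u n i ω| ^ (2 + 1 / K)) (μ n))
    (hu_mom : ∀ n i, ∫ ω, |u n i ω| ^ (2 + 1 / K) ∂(μ n) ≤ K)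
    -- many units of the same treatment status in balls of radius `η / C n`
    (h_density : ∀ η : ℝ, 0 < η → BiasAwareCI.MinCountTendsto x d fun n => η / C n)
    -- the overlap condition
    (X : Set E) (hX : ∀ n i, x n i ∈ X)
    (Gup Glo Ginv : ℝ → ℝ)
    (hGup : ∀ a, 0 < a → 0 < Gup a) (hGlo : ∀ a, 0 < a → 0 < Glo a)
    (hGinv : ∀ᶠ t in 𝓝[>] (0 : ℝ), 0 < Ginv t ∧ Glo (Ginv t) = t)
    (hG : Tendsto (fun t : ℝ => Gup (Ginv t) ^ 2 / (t / Real.log t⁻¹)) (𝓝[>] 0) (𝓝 0))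
    (h_overlap : ∀ a : ℕ → ℝ, (∀ n, 0 < a n) →
      Tendsto (fun n : ℕ => (n : ℝ) * Glo (a n) / Real.log n) atTop atTop →
      ∀ᶠ n : ℕ in atTop, ∀ z ∈ X, ∀ t : Bool,
        Glo (a n) ≤ (BiasAwareCI.ballCount (x n) (d n) z t (a n) : ℝ) / n ∧
        (BiasAwareCI.ballCount (x n) (d n) z t (a n) : ℝ) / n ≤ Gup (a n))
    -- the matching estimator with `M` matches
    (M : ℕ) (hM : 1 ≤ M) (S : (n : ℕ) → Fin n → Finset (Fin n))
    (hS : ∀ᶠ n in atTop, BiasAwareCI.IsMatching (x n) (d n) M (S n))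
    (α : ℝ) (hα : α ∈ Set.Ioo (0 : ℝ) 1) :
    -- nearest-neighbor variance estimator
    (∀ ν : Seminorm ℝ E, (∀ z, ν z = 0 → z = 0) →
      ∀ J : ℕ, 1 ≤ J → ∀ N : (n : ℕ) → Fin n → Finset (Fin n),
        (∀ᶠ n in atTop, BiasAwareCI.IsNeighborSystem ν (x n) (d n) J (N n)) →
        BiasAwareCI.UniformlyValid μ u α C x d
          (fun n => BiasAwareCI.matchWeight (d n) M (S n))
          (fun n => BiasAwareCI.nnVar J (N n))) ∧
    -- Nadaraya-Watson residuals, for every bandwidth such that `h n * C n` tends to zero and the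
    -- windows fill up; this is so whenever `h n * C n` tends to zero slowly enough
    (∀ h : ℕ → ℝ, Tendsto (fun n => h n * C n) atTop (𝓝 0) →
      BiasAwareCI.MinCountTendsto x d h →
      BiasAwareCI.UniformlyValid μ u α C x d
        (fun n => BiasAwareCI.matchWeight (d n) M (S n))
        (fun n => BiasAwareCI.nwVar (x n) (d n) (h n))) ∧
    (∃ ρ : ℕ → ℝ, (∀ n, 0 < ρ n) ∧ Tendsto ρ atTop (𝓝 0) ∧
      ∀ h : ℕ → ℝ, (∀ᶠ n in atTop, ρ n ≤ h n * C n) → BiasAwareCI.MinCountTendsto x d h) := by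
  have h2 : ∀ n i, Integrable (fun ω => u n i ω ^ 2) (μ n) := fun n i =>
    BiasAwareCI.integrable_sq_of_rpow (hu_meas n i) (by positivity) (hu_int n i)
  have h1 : ∀ n i, Integrable (u n i) (μ n) := fun n i =>
    (BiasAwareCI.memLp_two_of_integrable_sq (hu_meas n i) (h2 n i)).integrable (by norm_num)
  have hUI := BiasAwareCI.uniformlySquareIntegrable_of_moment hK hu_int hu_mom
  have hbias : ∀ᶠ n in atTop, ∀ f ∈ BiasAwareCI.FLip (E := E) (C n),
      |∑ i, BiasAwareCI.matchWeight (d n) M (S n) i * f (x n i) (d n i) -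
        BiasAwareCI.cate (x n) f| ≤
      BiasAwareCI.maxBias (C n) (x n) (d n) (BiasAwareCI.matchWeight (d n) M (S n)) := by
    filter_upwards [hS] with n hn f hf
    exact BiasAwareCI.abs_matching_bias_le_maxBias hM hn hf
  have hkpos : ∀ᶠ n in atTop, 0 < ∑ i, BiasAwareCI.matchWeight (d n) M (S n) i ^ 2 := by
    filter_upwards [eventually_ge_atTop 1] with n hn
    have : (0 : ℝ) < n := by positivity
    exact (show (0 : ℝ) < 1 / n by positivity).trans_le BiasAwareCI.inv_le_sum_matchWeight_sq
  obtain ⟨a, ha, hacount, haweight⟩ :=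
    BiasAwareCI.exists_radius_sum_window_le hX hGup hGinv hG h_overlap hM hS
  have hmax : ∀ ε : ℝ, 0 < ε → ∀ᶠ n in atTop, ∀ i,
      BiasAwareCI.matchWeight (d n) M (S n) i ^ 2 ≤
        ε * ∑ j, BiasAwareCI.matchWeight (d n) M (S n) j ^ 2 := by
    intro ε hε
    filter_upwards [haweight 0 ε hε] with n hn i
    refine le_trans ?_ (hn i)
    exact Finset.single_le_sum (f := fun m => BiasAwareCI.matchWeight (d n) M (S n) m ^ 2)
      (fun _ _ => sq_nonneg _) (by simp [BiasAwareCI.window])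
  -- constant radii are admissible in the overlap condition, whatever the size of `C n`
  have hdense : ∀ r : ℝ, 0 < r → BiasAwareCI.MinCountTendsto x d fun _ => r := by
    intro r hr B
    have hlog := BiasAwareCI.tendsto_natCast_mul_div_log (hGlo r hr)
    filter_upwards [BiasAwareCI.eventually_le_ballCount (a := fun _ => r) hlog
      ((h_overlap (fun _ => r) (fun _ => hr) hlog).mono fun n h z hz t => (h z hz t).1) B]
      with n hn i
    exact hn _ (hX n i) _
  refine ⟨fun ν hν J hJ N hN => ?_, fun h hh hcount => ?_,
    BiasAwareCI.exists_slow_bandwidth hC h_density⟩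
  · exact BiasAwareCI.uniformlyValid_of_variance_consistent hC hu_meas hu_indep h1 hu_mean h2 hK
      hu_var_lower hu_var_upper hUI hα hbias hkpos hmax fun ε hε =>
        BiasAwareCI.nnVar_consistent hu_meas hu_indep hu_mean h2 hu_var hσ hK hu_var_upper hUI hC
          hkpos ha (fun B => (hacount B).mono fun n hn i => hn _ (hX n i) _) haweight h_density
          hdense hν hJ hN hε
  · exact BiasAwareCI.uniformlyValid_of_variance_consistent hC hu_meas hu_indep h1 hu_mean h2 hK
      hu_var_lower hu_var_upper hUI hα hbias hkpos hmax fun ε hε =>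
        BiasAwareCI.nwVar_consistent hu_meas hu_indep hu_mean h2 hK hu_var_upper hUI hC hkpos hmax
          hh hcount hε
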